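/- Let $\mathfrak o$ be a complete discrete valuation ring with finite residue field, $\ell\in\mathbb N$, $\mathfrak o_\ell=\mathfrak o/\mathfrak p^\ell$, let $R$ be a finite (not necessarily commutative) $\mathfrak o_\ell$-algebra, and let $K$ be an algebraically closed field of characteristic $0$. Let $M=M_1^{a_1}\oplus\cdots\oplus M_n^{a_n}$, where $M_1,\dots,M_n$ are pairwise non-isomorphic finite indecomposable $R$-modules and all $a_i>0$, and let $V$ be an irreducible representation of $\operatorname{Aut}_R(M)$ over $K$. *Trivial functor morphing.* Let $\mathcal C$ be the full subcategory of $R$-modules isomorphic to $\bigoplus_i M_i^{b_i}$, $b_i\in\mathbb N$, and $\mathcal C_{+1}$ the category of $\mathfrak o_\ell$-linear functors $\mathcal C\to\mathfrak o_\ell\text{-Mod}$. For $F,G\in\mathcal C_{+1}$ write $G\prec F$ if $G$ is isomorphic to a subquotient of $F$ and $G\not\cong F$. Let $KF(M)$ be the permutation representation of $\operatorname{Aut}_R(M)$ with basis $F(M)$, and $\overline{KF(M)}$ its largest subrepresentation with $\operatorname{Hom}_{\operatorname{Aut}_R(M)}(KG(M),\overline{KF(M)})=0$ for all $G\prec F$.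 The functor morphing of $V$ is $(M,V)\leadsto(F,\widetilde V)$ if $\operatorname{Hom}_{\operatorname{Aut}_R(M)}(KF(M),V)\neq 0$, $\operatorname{Hom}_{\operatorname{Aut}_R(M)}(KG(M),V)=0$ for all $G\prec F$, and $\widetilde V\cong\operatorname{Hom}_{\operatorname{Aut}_R(M)}(\overline{KF(M)},V)$ as representations of $\operatorname{Aut}(F)$. It is trivial if $F=\operatorname{Hom}_R(M,-)$ and $\widetilde V\cong V$ under the Yoneda isomorphism $\operatorname{Aut}(F)\cong\operatorname{Aut}_R(M)$. *The left maximal graph.* A morphism $f:M_j\to M_i$ is left maximal if it is non-zero, not invertible, and $gf=0$ for every $k$ and every non-invertible $g:M_i\to M_k$. Let $E_i$ be the quotient of $\operatorname{End}_R(M_i)$ by its Jacobson radical (a finite field). The left maximal morphisms $M_j\to M_i$ together with $0$ form an $E_i$-vector space $LM(M_j,M_i)$. The directed graph $LM(M_1,\dots,M_n)$ has vertices $1,\dots,n$ and $\dim_{E_i}LM(M_j,M_i)$ arrows from $j$ to $i$. **Theorem.** Suppose that $V$ admits trivial functor morphing. Suppose moreover that (a) if $n=1$, then $\operatorname{End}_R(M_1)$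 is not a field (it contains a non-zero non-invertible element); (b) if the graph $LM(M_1,\dots,M_n)$ has an arrow between two distinct vertices, then it has such an arrow $j\to i$, $j\neq i$, with $(a_j,|E_j|)\neq(1,2)$. Then at least one of the following holds: 1. There is a splitting $M=M'\oplus M''$ with $M',M''\neq0$ and $\operatorname{Aut}_R(M)=\operatorname{Aut}_R(M')\times\operatorname{Aut}_R(M'')$, that is, every automorphism of $M$ is the direct sum of an automorphism of $M'$ and one of $M''$. 2. $V$ is induced from a proper subgroup of $\operatorname{Aut}_R(M)$ that is isomorphic to $\operatorname{Aut}_{\widetilde R}(\widetilde M)$. Here $\widetilde R=R\oplus (R\otimes_{\mathbb Z}R)$, with $b_1\otimes b_2$ written $b_1xb_2$ and product $(a+b_1xb_2)(c+d_1xd_2)=ac+ad_1xd_2+b_1xb_2c$; and $\widetilde M$ is $M$ as an $R$-module, with $x$ acting as follows. There are a cycle $v_0\to v_1\to\cdots\to v_k\to v_0$ of $k+1>1$ distinct vertices of $LM(M_1,\dots,M_n)$, with exactly one arrow from each vertex to the next and with $a_{v_0}=\cdots=a_{v_k}=:a$, and basis elements $f_p\in LM(M_{v_p},M_{v_{p+1}})$,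 $0\le p<k$, such that $x$ maps $(m_1,\dots,m_a)\in M_{v_p}^{a}$ to $(f_p(m_1),\dots,f_p(m_a))\in M_{v_{p+1}}^{a}$ for $p<k$ and is zero on all other summands $M_j^{a_j}$. 3. The graph $LM(M_1,\dots,M_n)$ is a disjoint union of single vertices, each with exactly one self-loop. -/

import Mathlib

open CategoryTheory

universe u v w

namespace FunctorMorphing

noncomputable section

/-! ### Modules -/

section Modules

variable {R : Type u} [Ring R] {ι : Type} (N : ι → Type v)
  [∀ i, AddCommGroup (N i)] [∀ i, Module R (N i)]

/-- A module is indecomposable if it is non-zero and is not the direct sum of two non-zero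
submodules. -/
def IsIndecomposable (R : Type u) [Ring R] (X : Type v) [AddCommGroup X] [Module R X] : Prop :=
  Nontrivial X ∧ ∀ P Q : Submodule R X, IsCompl P Q → P = ⊥ ∨ Q = ⊥

/-- The module `⨁ᵢ Nᵢ ^ aᵢ` (the index set is finite in all applications). -/
abbrev BigModule (a : ι → ℕ) : Type v := (i : ι) → Fin (a i) → N i

end Modules

/-! ### The category `𝒞 = ⟨N₁, …, Nₙ⟩` and the functor category `𝒞₊₁` -/

section Functors

variable (A : Type w) [CommRing A] (R : Type u) [Ring R] [Algebra A R]
  {ι : Type} (N : ι → Type v) [∀ i, AddCommGroup (N i)] [∀ i, Module R (N i)]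

/-- For an `A`-algebra `R`, the category of `R`-modules is `A`-linear. -/
@[reducible] def moduleCatLinear : Linear A (ModuleCat.{v} R) :=
  letI (X : ModuleCat.{v} R) : Module A X := Module.restrictScalars A R X
  haveI (X : ModuleCat.{v} R) : IsScalarTower A R X := IsScalarTower.restrictScalars A R X
  { homModule := fun _ _ => inferInstance
    smul_comp := by intros; ext; simp
    comp_smul := by intros; ext; simp }

/-- The `R`-modules isomorphic to `⨁ᵢ Nᵢ ^ bᵢ` for some multiplicities `bᵢ`. -/
def isSum : ObjectProperty (ModuleCat.{v} R) := fun X =>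
  ∃ b : ι → ℕ, Nonempty (X ≃ₗ[R] BigModule N b)

/-- The full subcategory `𝒞 = ⟨N₁, …, Nₙ⟩` of the category of `R`-modules. -/
abbrev SumCat := (isSum R N).FullSubcategory

instance sumCatLinear : Linear A (SumCat R N) :=
  letI := moduleCatLinear.{u, v} A R
  Linear.fullSubcategory (isSum R N)

/-- `𝒞₊₁`: the category of `A`-linear functors from `𝒞` to `A`-modules. -/
abbrev FunCat := ObjectProperty.FullSubcategory
  (fun F : SumCat R N ⥤ ModuleCat.{v} A => F.Additive ∧ F.Linear A)

variable {A R N}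

/-- `F ≼ G`: the functor `F` is isomorphic to a subquotient of `G`, i.e. it is a quotient of a
subfunctor `H` of `G`. -/
def IsSubquotient (F G : FunCat A R N) : Prop :=
  ∃ (H : FunCat A R N) (i : H ⟶ G) (p : H ⟶ F),
    (∀ X, Function.Injective (i.hom.app X)) ∧ (∀ X, Function.Surjective (p.hom.app X))

/-- `F ≺ G`. -/
def IsProperSubquotient (F G : FunCat A R N) : Prop :=
  IsSubquotient F G ∧ ¬ Nonempty (F ≅ G)

variable (R N)

/-- `M = ⨁ᵢ Nᵢ ^ aᵢ` as an object of `𝒞`. -/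
def bigObj (a : ι → ℕ) : SumCat R N :=
  ⟨ModuleCat.of R (BigModule N a), a, ⟨LinearEquiv.refl R _⟩⟩

/-- An endomorphism of `M` as a morphism of `𝒞`. -/
def bigHom (a : ι → ℕ) (g : BigModule N a →ₗ[R] BigModule N a) : bigObj R N a ⟶ bigObj R N a :=
  ObjectProperty.homMk (ModuleCat.ofHom g)

lemma bigHom_id (a : ι → ℕ) : bigHom R N a LinearMap.id = 𝟙 _ := rfl

lemma bigHom_comp (a : ι → ℕ) (g h : BigModule N a →ₗ[R] BigModule N a) :
    bigHom R N a (g ∘ₗ h) = bigHom R N a h ≫ bigHom R N a g := rfl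

variable (A)

/-- The functor `F_M = Hom(M, -)`. -/
def homFunctor (a : ι → ℕ) : FunCat A R N :=
  ⟨(linearCoyoneda A (SumCat R N)).obj (Opposite.op (bigObj R N a)),
    inferInstance, ⟨fun f r => ModuleCat.hom_ext (LinearMap.ext fun x => Linear.comp_smul _ _ _ x r f)⟩⟩

/-- Precomposition with an endomorphism `g` of `M`, as an endomorphism of `F_M`. -/
def precomp (a : ι → ℕ) (g : BigModule N a →ₗ[R] BigModule N a) :
    homFunctor A R N a ⟶ homFunctor A R N a :=
  ObjectProperty.homMk ((linearCoyoneda A (SumCat R N)).map (bigHom R N a g).op)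

lemma precomp_id (a : ι → ℕ) : precomp A R N a LinearMap.id = 𝟙 _ :=
  InducedCategory.Hom.ext ((linearCoyoneda A (SumCat R N)).map_id _)

lemma precomp_comp (a : ι → ℕ) (g h : BigModule N a →ₗ[R] BigModule N a) :
    precomp A R N a (g ∘ₗ h) = precomp A R N a g ≫ precomp A R N a h :=
  InducedCategory.Hom.ext
    ((linearCoyoneda A (SumCat R N)).map_comp (bigHom R N a g).op (bigHom R N a h).op)

/-- The Yoneda homomorphism `Aut_R(M) → Aut(F_M)`, sending `g` to precomposition with `g⁻¹`. -/
def yonedaAut (a : ι → ℕ) :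
    (BigModule N a ≃ₗ[R] BigModule N a) →* Aut (homFunctor A R N a) where
  toFun g :=
    { hom := precomp A R N a (g⁻¹ : BigModule N a ≃ₗ[R] BigModule N a)
      inv := precomp A R N a g
      hom_inv_id := by
        rw [← precomp_comp, ← precomp_id]
        congr 1
        exact LinearMap.ext g.symm_apply_apply
      inv_hom_id := by
        rw [← precomp_comp, ← precomp_id]
        congr 1
        exact LinearMap.ext g.apply_symm_apply }
  map_one' := Iso.ext (precomp_id A R N a)
  map_mul' g h := by
    apply Iso.ext
    change precomp A R N a ((g * h)⁻¹ : BigModule N a ≃ₗ[R] BigModule N a) = _ ≫ _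
    rw [mul_inv_rev]
    exact precomp_comp A R N a _ _

/-! ### The permutation representations `KF(M)` and functor morphing -/

variable {A R N}
variable (K : Type*) [Field K]

/-- The vector space `KF(M)` with basis `F(M)`. -/
abbrev PermSpace (a : ι → ℕ) (F : FunCat A R N) := F.obj.obj (bigObj R N a) →₀ K

/-- The map `F(g) : F(M) → F(M)`. -/
def evalMap (a : ι → ℕ) (F : FunCat A R N) (g : BigModule N a →ₗ[R] BigModule N a) :
    F.obj.obj (bigObj R N a) → F.obj.obj (bigObj R N a) :=
  F.obj.map (bigHom R N a g)

lemma evalMap_id (a : ι → ℕ) (F : FunCat A R N) : evalMap a F LinearMap.id = id := by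
  funext x
  exact congr($(F.obj.map_id (bigObj R N a)) x)

lemma evalMap_comp (a : ι → ℕ) (F : FunCat A R N) (g h : BigModule N a →ₗ[R] BigModule N a) :
    evalMap a F (g ∘ₗ h) = evalMap a F g ∘ evalMap a F h := by
  funext x
  exact congr($(F.obj.map_comp (bigHom R N a h) (bigHom R N a g)) x)

/-- The representation of `Aut_R(M)` on `KF(M)` permuting the basis `F(M)`. -/
def permRep (a : ι → ℕ) (F : FunCat A R N) :
    Representation K (BigModule N a ≃ₗ[R] BigModule N a) (PermSpace K a F) where
  toFun g := Finsupp.lmapDomain K K (evalMap a F g)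
  map_one' := by
    change Finsupp.lmapDomain K K (evalMap a F LinearMap.id) = LinearMap.id
    rw [evalMap_id, Finsupp.lmapDomain_id]
  map_mul' g h := by
    change Finsupp.lmapDomain K K (evalMap a F (g ∘ₗ (h : BigModule N a →ₗ[R] BigModule N a))) = _
    rw [evalMap_comp, Finsupp.lmapDomain_comp]
    rfl

/-- The intertwiner `α_* : KF(M) → KG(M)` of a natural transformation `α : F → G`. -/
def pushforward (a : ι → ℕ) {F G : FunCat A R N} (α : F ⟶ G) :
    (permRep K a F).IntertwiningMap (permRep K a G) where
  toLinearMap := Finsupp.lmapDomain K K (α.hom.app (bigObj R N a))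
  isIntertwining' g := by
    change Finsupp.lmapDomain K K _ ∘ₗ Finsupp.lmapDomain K K _ =
      Finsupp.lmapDomain K K _ ∘ₗ Finsupp.lmapDomain K K _
    rw [← Finsupp.lmapDomain_comp, ← Finsupp.lmapDomain_comp]
    congr 1
    funext x
    exact congr($(α.hom.naturality (bigHom R N a (g : BigModule N a →ₗ[R] BigModule N a))) x)

lemma pushforward_id (a : ι → ℕ) (F : FunCat A R N) (x : PermSpace K a F) :
    pushforward K a (𝟙 F) x = x := Finsupp.mapDomain_id

lemma pushforward_comp (a : ι → ℕ) {F G H : FunCat A R N} (α : F ⟶ G) (β : G ⟶ H)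
    (x : PermSpace K a F) :
    pushforward K a (α ≫ β) x = pushforward K a β (pushforward K a α x) :=
  Finsupp.mapDomain_comp (v := x) (f := α.hom.app (bigObj R N a))
    (g := β.hom.app (bigObj R N a))

/-- A subrepresentation `U` of `KF(M)` with `Hom(KG(M), U) = 0` for all `G ≺ F`. -/
def AvoidsSmaller (a : ι → ℕ) {F : FunCat A R N} (U : Subrepresentation (permRep K a F)) : Prop :=
  ∀ G : FunCat A R N, IsProperSubquotient G F →
    ∀ T : (permRep K a G).IntertwiningMap U.toRepresentation, T = 0

lemma AvoidsSmaller.exists_image {a : ι → ℕ} {F : FunCat A R N}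
    {U : Subrepresentation (permRep K a F)} (hU : AvoidsSmaller K a U) (α : Aut F) :
    ∃ U' : Subrepresentation (permRep K a F), AvoidsSmaller K a U' ∧
      ∀ x ∈ U.toSubmodule, pushforward K a α.hom x ∈ U'.toSubmodule := by
  refine ⟨⟨U.toSubmodule.map (pushforward K a α.hom).toLinearMap, ?_⟩, ?_, ?_⟩
  · rintro g _ ⟨x, hx, rfl⟩
    exact ⟨permRep K a F g x, U.apply_mem_toSubmodule g hx,
      congr($((pushforward K a α.hom).isIntertwining' g) x)⟩
  · intro G hG T
    have key : ∀ y, ∃ x ∈ U.toSubmodule, pushforward K a α.hom x = (T y).1 := fun y => (T y).2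
    have hmem : ∀ y, pushforward K a α.inv (T y).1 ∈ U.toSubmodule := by
      intro y
      obtain ⟨x, hx, h⟩ := key y
      rw [← h, ← pushforward_comp, α.hom_inv_id, pushforward_id]
      exact hx
    have h0 := hU G hG
      ⟨LinearMap.codRestrict U.toSubmodule ((pushforward K a α.inv).toLinearMap ∘ₗ
        Submodule.subtype _ ∘ₗ T.toLinearMap) hmem, by
        intro g
        refine LinearMap.ext fun y => Subtype.ext ?_
        change pushforward K a α.inv (T (permRep K a G g y)).1 =
          permRep K a F g (pushforward K a α.inv (T y).1)
        rw [T.isIntertwining, ← (pushforward K a α.inv).isIntertwining]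
        rfl⟩
    apply Representation.IntertwiningMap.ext
    refine LinearMap.ext fun y => Subtype.ext ?_
    have h1 : pushforward K a α.inv (T y).1 = 0 :=
      congrArg Subtype.val (DFunLike.congr_fun h0 y)
    have h2 := congrArg (pushforward K a α.hom) h1
    rw [← pushforward_comp, α.inv_hom_id, pushforward_id, map_zero] at h2
    exact h2
  · intro x hx
    exact ⟨x, hx, rfl⟩

/-- `\overline{KF(M)}`: the largest subrepresentation of `KF(M)` with no non-zero map from any
`KG(M)` with `G ≺ F`, as the sum of all such subrepresentations. -/
def layer (a : ι → ℕ) (F : FunCat A R N) : Subrepresentation (permRep K a F) where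
  toSubmodule := ⨆ U : {U : Subrepresentation (permRep K a F) // AvoidsSmaller K a U},
    U.1.toSubmodule
  apply_mem_toSubmodule g x hx := by
    have : (⨆ U : {U : Subrepresentation (permRep K a F) // AvoidsSmaller K a U},
        U.1.toSubmodule) ≤ (⨆ U : {U : Subrepresentation (permRep K a F) // AvoidsSmaller K a U},
        U.1.toSubmodule).comap (permRep K a F g) :=
      iSup_le fun U y hy => Submodule.mem_iSup_of_mem U (U.1.apply_mem_toSubmodule g hy)
    exact this hx

lemma pushforward_mem_layer (a : ι → ℕ) (F : FunCat A R N) (α : Aut F) (x : PermSpace K a F)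
    (hx : x ∈ (layer K a F).toSubmodule) :
    pushforward K a α.hom x ∈ (layer K a F).toSubmodule := by
  have : (layer K a F).toSubmodule ≤
      (layer K a F).toSubmodule.comap (pushforward K a α.hom).toLinearMap := by
    refine iSup_le fun U y hy => ?_
    obtain ⟨U', hU', h⟩ := U.2.exists_image K α
    exact Submodule.mem_iSup_of_mem ⟨U', hU'⟩ (h y hy)
  exact this hx

/-- The action of `α ∈ Aut(F)` on `\overline{KF(M)}`. -/
def layerMap (a : ι → ℕ) (F : FunCat A R N) (α : Aut F) :
    (layer K a F).toRepresentation.IntertwiningMap (layer K a F).toRepresentation where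
  toLinearMap := (pushforward K a α.hom).toLinearMap.restrict
    (pushforward_mem_layer K a F α)
  isIntertwining' g := by
    ext1 x
    exact Subtype.ext congr($((pushforward K a α.hom).isIntertwining' g) x.1)

variable {V : Type*} [AddCommGroup V] [Module K V] {a : ι → ℕ}

variable {K}

/-- The representation `Hom_{Aut_R(M)}(\overline{KF(M)}, V)` of `Aut(F)`, where `α` acts by
precomposition with `α⁻¹`. For an `F`-typical irreducible `V` this is the dual of the multiplicity
space of `V` in `\overline{KF(M)}`. -/
def morphRep (F : FunCat A R N)
    (ρ : Representation K (BigModule N a ≃ₗ[R] BigModule N a) V) :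
    Representation K (Aut F) ((layer K a F).toRepresentation.IntertwiningMap ρ) where
  toFun α :=
    { toFun := fun T => T.comp (layerMap K a F α⁻¹)
      map_add' := fun _ _ => rfl
      map_smul' := fun _ _ => rfl }
  map_one' := by
    ext T x
    change T (layerMap K a F 1⁻¹ x) = T x
    congr 1
    rw [inv_one]
    exact Subtype.ext (pushforward_id K a F x.1)
  map_mul' α β := by
    ext T x
    change T (layerMap K a F (α * β)⁻¹ x) = T (layerMap K a F β⁻¹ (layerMap K a F α⁻¹ x))
    congr 1
    rw [mul_inv_rev]
    exact Subtype.ext (pushforward_comp K a (α⁻¹).hom (β⁻¹).hom x.1)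

/-- `V` is `F`-typical: `V` occurs in `KF(M)` but in no `KG(M)` with `G ≺ F`. -/
def IsTypical (F : FunCat A R N)
    (ρ : Representation K (BigModule N a ≃ₗ[R] BigModule N a) V) : Prop :=
  (∃ T : (permRep K a F).IntertwiningMap ρ, T ≠ 0) ∧
    ∀ G : FunCat A R N, IsProperSubquotient G F → ∀ T : (permRep K a G).IntertwiningMap ρ, T = 0

/-- The functor morphing relation `(M, V) ⇝ (F, Ṽ)`. -/
def Morphs (ρ : Representation K (BigModule N a ≃ₗ[R] BigModule N a) V)
    (F : FunCat A R N) {V' : Type*} [AddCommGroup V'] [Module K V']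
    (τ : Representation K (Aut F) V') : Prop :=
  IsTypical F ρ ∧ Nonempty (τ.Equiv (morphRep F ρ))

variable (A)

/-- `V` admits trivial functor morphing: `(M, V) ⇝ (Hom(M, -), V)`, where `Aut(Hom(M, -))` acts on
`V` through the Yoneda isomorphism with `Aut_R(M)`. -/
def HasTrivialMorphing (ρ : Representation K (BigModule N a ≃ₗ[R] BigModule N a) V) : Prop :=
  ∃ τ : Representation K (Aut (homFunctor A R N a)) V,
    (∀ g, τ (yonedaAut A R N a g) = ρ g) ∧ Morphs ρ (homFunctor A R N a) τ

end Functors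

/-! ### The left maximal graph -/

section Graph

variable {R : Type u} [Ring R] {ι : Type} (N : ι → Type v)
  [∀ i, AddCommGroup (N i)] [∀ i, Module R (N i)]

/-- `f : N_j → N_i` is left maximal: it is non-zero, not invertible, and is killed by every
non-invertible morphism out of `N_i` to some `N_k`. -/
def IsLeftMaximal {j i : ι} (f : N j →ₗ[R] N i) : Prop :=
  f ≠ 0 ∧ ¬ Function.Bijective f ∧
    ∀ (k : ι) (g : N i →ₗ[R] N k), ¬ Function.Bijective g → g ∘ₗ f = 0

variable (R)

/-- The residue ring `E_i` of `End(N_i)` modulo its Jacobson radical. -/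
abbrev Residue (i : ι) : Type v :=
  Module.End R (N i) ⧸ Ring.jacobson (Module.End R (N i))

/-- `LM(N_j, N_i)`. For pairwise non-isomorphic finite indecomposable modules, the left maximal
morphisms together with `0` already form an `End(N_i)`-submodule under postcomposition, and the
span below adds nothing. -/
def LM (j i : ι) : Submodule (Module.End R (N i)) (N j →ₗ[R] N i) :=
  Submodule.span _ {f | IsLeftMaximal N f}

lemma not_bijective_of_mem_jacobson {i : ι} [Nontrivial (N i)] {u : Module.End R (N i)}
    (hu : u ∈ Ring.jacobson (Module.End R (N i))) : ¬ Function.Bijective u := by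
  intro hb
  have hunit : IsUnit u := (Module.End.isUnit_iff u).2 hb
  have := Ideal.eq_top_of_isUnit_mem _ hu hunit
  exact (Ring.jacobson_lt_top (Module.End R (N i))).ne this

lemma isTorsion_LM (j i : ι) : Module.IsTorsionBySet (Module.End R (N i)) (LM R N j i)
    (Ring.jacobson (Module.End R (N i)) : Ideal (Module.End R (N i))) := by
  rintro ⟨f, hf⟩ ⟨u, hu⟩
  apply Subtype.ext
  change u • f = 0
  rcases subsingleton_or_nontrivial (N i) with hs | hs
  · ext x; exact Subsingleton.elim _ _
  · revert u
    induction hf using Submodule.span_induction with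
    | mem f hf =>
      intro u hu
      exact hf.2.2 i u (not_bijective_of_mem_jacobson R N hu)
    | zero => intro u _; simp
    | add f g _ _ h1 h2 => intro u hu; rw [smul_add, h1 u hu, h2 u hu, add_zero]
    | smul e f _ h =>
      intro u hu
      rw [smul_smul]
      exact h _ (Ideal.mul_mem_right e _ hu)

/-- The `E_i`-vector space structure on `LM(N_j, N_i)`, by postcomposition. -/
instance moduleLM (j i : ι) : Module (Residue R N i) (LM R N j i) :=
  (isTorsion_LM R N j i).module

/-- The number `dim_{E_i} LM(N_j, N_i)` of arrows from `j` to `i` in the directed multigraph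
`LM(N₁, …, Nₙ)`, whose vertices are the indices. -/
def numArrows (j i : ι) : ℕ := Module.finrank (Residue R N i) (LM R N j i)

/-- The left maximal graph is a disjoint union of single vertices, each with exactly one
self-loop. -/
def IsUnionOfLoops : Prop :=
  (∀ i, numArrows R N i i = 1) ∧ ∀ j i, j ≠ i → numArrows R N j i = 0

end Graph

/-! ### The auxiliary ring `R̃ = R ⊕ R ⊗ R` and its modules -/

section Auxiliary

open scoped TensorProduct

variable (R : Type u) [Ring R]

/-- The free `R`-bimodule `R ⊗_ℤ R = RxR` on one generator `x = 1 ⊗ 1`. -/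
def FreeBimodule : Type u := R ⊗[ℤ] R

namespace FreeBimodule

instance : AddCommGroup (FreeBimodule R) := inferInstanceAs (AddCommGroup (R ⊗[ℤ] R))

/-- Left action: `r (b₁ x b₂) = (r b₁) x b₂`. -/
instance : Module R (FreeBimodule R) := inferInstanceAs (Module R (R ⊗[ℤ] R))

/-- Right multiplication by `r` on the second factor: `(b₁ x b₂) r = b₁ x (b₂ r)`. -/
def rightMul : Rᵐᵒᵖ →+* AddMonoid.End (FreeBimodule R) where
  toFun r := (LinearMap.lTensor R (LinearMap.mulRight ℤ r.unop)).toAddMonoidHom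
  map_one' := by
    ext z
    change LinearMap.lTensor R (LinearMap.mulRight ℤ (1 : R)) z = z
    simp
  map_mul' r s := by
    ext z
    change LinearMap.lTensor R (LinearMap.mulRight ℤ (s.unop * r.unop)) z =
      LinearMap.lTensor R (LinearMap.mulRight ℤ r.unop)
        (LinearMap.lTensor R (LinearMap.mulRight ℤ s.unop) z)
    rw [LinearMap.mulRight_mul, LinearMap.lTensor_comp]
    rfl
  map_zero' := by
    ext z
    change LinearMap.lTensor R (LinearMap.mulRight ℤ (0 : R)) z = 0
    simp
  map_add' r s := by
    ext z
    change LinearMap.lTensor R (LinearMap.mulRight ℤ (r.unop + s.unop)) z =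
      LinearMap.lTensor R (LinearMap.mulRight ℤ r.unop) z +
        LinearMap.lTensor R (LinearMap.mulRight ℤ s.unop) z
    have : LinearMap.mulRight ℤ (r.unop + s.unop) =
      LinearMap.mulRight ℤ r.unop + LinearMap.mulRight ℤ s.unop := by
      ext; simp [mul_add]
    rw [this, LinearMap.lTensor_add]
    rfl

instance : Module Rᵐᵒᵖ (FreeBimodule R) := Module.compHom _ (rightMul R)

variable {R}

/-- The element `b₁ x b₂`. -/
def mk (b₁ b₂ : R) : FreeBimodule R := b₁ ⊗ₜ[ℤ] b₂

lemma smul_mk (r b₁ b₂ : R) : r • mk b₁ b₂ = mk (r * b₁) b₂ :=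
  TensorProduct.smul_tmul' r b₁ b₂

lemma op_smul_mk (r b₁ b₂ : R) : MulOpposite.op r • mk b₁ b₂ = mk b₁ (b₂ * r) :=
  rfl

@[elab_as_elim]
lemma induction {p : FreeBimodule R → Prop} (z : FreeBimodule R) (h0 : p 0)
    (hm : ∀ b₁ b₂, p (mk b₁ b₂)) (ha : ∀ y z, p y → p z → p (y + z)) : p z :=
  TensorProduct.induction_on (motive := p) z h0 hm ha

instance : SMulCommClass R Rᵐᵒᵖ (FreeBimodule R) where
  smul_comm r s z := by
    induction z using FreeBimodule.induction with
    | h0 => simp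
    | hm b₁ b₂ =>
      obtain ⟨s, rfl⟩ := MulOpposite.op_surjective s
      rw [op_smul_mk, smul_mk, smul_mk, op_smul_mk]
    | ha y z hy hz => simp only [smul_add, hy, hz]

end FreeBimodule

/-- The ring `R̃ = R ⊕ R ⊗_ℤ R = R ⊕ RxR`, with product
`(a + b₁xb₂)(c + d₁xd₂) = ac + ad₁xd₂ + b₁xb₂c`. -/
abbrev RTilde : Type u := TrivSqZeroExt R (FreeBimodule R)

variable {R} {X : Type v} [AddCommGroup X] [Module R X]

/-- An `R`-linear endomorphism as an additive one. -/
def endOf (t : X →ₗ[R] X) : AddMonoid.End X := t.toAddMonoidHom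

/-- The additive map by which `∑ b₁ x b₂` acts when `x` acts as `t`: `m ↦ ∑ b₁ t(b₂ m)`. -/
def bimoduleAct (t : X →ₗ[R] X) : FreeBimodule R →+ AddMonoid.End X :=
  TensorProduct.liftAddHom
    { toFun := fun b₁ =>
        { toFun := fun b₂ => Module.toAddMonoidEnd R X b₁ * endOf t *
            Module.toAddMonoidEnd R X b₂
          map_zero' := by simp
          map_add' := fun _ _ => by rw [map_add, mul_add] }
      map_zero' := by ext; simp
      map_add' := fun _ _ => by ext1; simp only [map_add, add_mul]; rfl }
    (fun r b₁ b₂ => by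
      change Module.toAddMonoidEnd R X (r • b₁) * _ * _ = _ * _ * Module.toAddMonoidEnd R X (r • b₂)
      rw [map_zsmul, map_zsmul, smul_mul_assoc, smul_mul_assoc, mul_smul_comm])

lemma bimoduleAct_mk (t : X →ₗ[R] X) (b₁ b₂ : R) (m : X) :
    bimoduleAct t (FreeBimodule.mk b₁ b₂) m = b₁ • t (b₂ • m) := rfl

/-- The ring homomorphism `R̃ → End(X)` extending the action of `R` by letting `x` act as `t`. -/
def tildeHom (t : X →ₗ[R] X) (ht : t ∘ₗ t = 0) : RTilde R →+* AddMonoid.End X where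
  toFun z := Module.toAddMonoidEnd R X z.fst + bimoduleAct t z.snd
  map_one' := by simp
  map_zero' := by simp
  map_add' y z := by
    simp only [TrivSqZeroExt.fst_add, TrivSqZeroExt.snd_add, map_add]
    abel
  map_mul' y z := by
    have h1 : ∀ (r : R) (w : FreeBimodule R),
        bimoduleAct t (r • w) = Module.toAddMonoidEnd R X r * bimoduleAct t w := by
      intro r w
      induction w using FreeBimodule.induction with
      | h0 => simp
      | hm b₁ b₂ =>
        ext m
        rw [FreeBimodule.smul_mk, bimoduleAct_mk, mul_smul]
        rfl
      | ha y z hy hz => rw [smul_add, map_add, hy, hz, map_add, mul_add]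
    have h2 : ∀ (r : R) (w : FreeBimodule R),
        bimoduleAct t (MulOpposite.op r • w) = bimoduleAct t w * Module.toAddMonoidEnd R X r := by
      intro r w
      induction w using FreeBimodule.induction with
      | h0 => simp
      | hm b₁ b₂ =>
        ext m
        rw [FreeBimodule.op_smul_mk, bimoduleAct_mk, mul_smul]
        rfl
      | ha y z hy hz => rw [smul_add, map_add, hy, hz, map_add, add_mul]
    have h3 : ∀ w w' : FreeBimodule R, bimoduleAct t w * bimoduleAct t w' = 0 := by
      intro w w'
      induction w using FreeBimodule.induction with
      | h0 => simp
      | hm b₁ b₂ =>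
        induction w' using FreeBimodule.induction with
        | h0 => simp
        | hm c₁ c₂ =>
          ext m
          change b₁ • t (b₂ • c₁ • t (c₂ • m)) = 0
          have : t (t (c₂ • m)) = 0 := congr($ht (c₂ • m))
          rw [map_smul, map_smul, this]
          simp
        | ha y z hy hz => rw [map_add, mul_add, hy, hz, add_zero]
      | ha y z hy hz => rw [map_add, add_mul, hy, hz, add_zero]
    simp only [TrivSqZeroExt.fst_mul, TrivSqZeroExt.snd_mul, map_add, map_mul, h1, h2, add_mul,
      mul_add, h3, add_zero]
    abel

/-- The `R̃`-module with underlying `R`-module `X` on which `x` acts as the square-zero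
endomorphism `t`. -/
def TildeModule (t : X →ₗ[R] X) (_ : t ∘ₗ t = 0) : Type v := X

instance (t : X →ₗ[R] X) (ht : t ∘ₗ t = 0) : AddCommGroup (TildeModule t ht) :=
  inferInstanceAs (AddCommGroup X)

instance (t : X →ₗ[R] X) (ht : t ∘ₗ t = 0) : Module (RTilde R) (TildeModule t ht) :=
  Module.compHom X (tildeHom t ht)

end Auxiliary

/-! ### Cycles of the left maximal graph and the module `M̃` -/

section Cycle

variable (R : Type u) [Ring R] {ι : Type} [DecidableEq ι] (N : ι → Type v)
  [∀ i, AddCommGroup (N i)] [∀ i, Module R (N i)] (a : ι → ℕ)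

/-- A directed cycle `v₀ → v₁ → ⋯ → v_k → v₀` of `k + 1 > 1` distinct vertices of the left maximal
graph, consecutive vertices being joined by exactly one arrow, with all multiplicities equal along
the cycle, together with a basis element `f_p` of the line `LM(N_{v_p}, N_{v_{p+1}})` for `p < k`. -/
structure LongCycle where
  k : ℕ
  one_le_k : 1 ≤ k
  v : Fin (k + 1) → ι
  v_injective : Function.Injective v
  -- addition in `Fin (k + 1)` is cyclic, so `p = k` gives the closing arrow
  numArrows_eq_one : ∀ p : Fin (k + 1), numArrows R N (v p) (v (p + 1)) = 1
  f : ∀ p : Fin k, N (v p.castSucc) →ₗ[R] N (v p.succ)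
  isLeftMaximal : ∀ p, IsLeftMaximal N (f p)
  mult_eq : ∀ p : Fin k, a (v p.castSucc) = a (v p.succ)

variable {R N a}

/-- The map `(m₁, …, m_a) ↦ (f m₁, …, f m_a)` from the summand `N_j ^ a` of `M` to `N_i ^ a`, zero
on the other summands. -/
def blockMap {j i : ι} (h : a j = a i) (f : N j →ₗ[R] N i) : BigModule N a →ₗ[R] BigModule N a :=
  LinearMap.single R (fun i => Fin (a i) → N i) i ∘ₗ LinearMap.funLeft R (N i) (Fin.cast h.symm) ∘ₗ
    f.compLeft (Fin (a j)) ∘ₗ LinearMap.proj j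

lemma blockMap_comp_blockMap {j i j' i' : ι} (h : a j = a i) (h' : a j' = a i')
    (f : N j →ₗ[R] N i) (hf : IsLeftMaximal N f) (g : N j' →ₗ[R] N i') (hg : IsLeftMaximal N g) :
    blockMap h' g ∘ₗ blockMap h f = 0 := by
  refine LinearMap.ext fun m => ?_
  change Pi.single (M := fun i => Fin (a i) → N i) i' (fun s => g ((Pi.single i (fun s => f (m j (Fin.cast h.symm s))) :
    BigModule N a) j' (Fin.cast h'.symm s))) = 0
  rw [Pi.single_eq_zero_iff]
  funext s
  by_cases hij : i = j'
  · subst hij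
    rw [Pi.single_eq_same]
    exact congr($(hf.2.2 i' g hg.2.1) _)
  · rw [Pi.single_eq_of_ne (Ne.symm hij)]
    exact map_zero g

/-- The action of `x` on `M`: it is `f_p` on each copy of `N_{v_p}`, into the corresponding copy of
`N_{v_{p+1}}`, for `p < k`, and zero on all other summands. -/
def LongCycle.shift (c : LongCycle R N a) : BigModule N a →ₗ[R] BigModule N a :=
  ∑ p : Fin c.k, blockMap (c.mult_eq p) (c.f p)

lemma LongCycle.shift_comp_shift (c : LongCycle R N a) : c.shift ∘ₗ c.shift = 0 := by
  change c.shift * c.shift = 0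
  rw [LongCycle.shift, Finset.sum_mul_sum]
  exact Finset.sum_eq_zero fun p _ => Finset.sum_eq_zero fun q _ =>
    blockMap_comp_blockMap _ _ _ (c.isLeftMaximal _) _ (c.isLeftMaximal _)

/-- The `R̃`-module `M̃` attached to a cycle. -/
abbrev LongCycle.MTilde (c : LongCycle R N a) : Type v := TildeModule c.shift c.shift_comp_shift

end Cycle

/-! ### The two reductions -/

section Reductions

/-- `X` has a splitting `X = P ⊕ Q` into non-zero submodules with `Aut(X) = Aut(P) × Aut(Q)`:
every automorphism of `X` is the direct sum of one of `P` and one of `Q`. -/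
def AutSplits (R : Type u) [Ring R] (X : Type v) [AddCommGroup X] [Module R X] : Prop :=
  ∃ P Q : Submodule R X, IsCompl P Q ∧ P ≠ ⊥ ∧ Q ≠ ⊥ ∧
    ∀ g : X ≃ₗ[R] X, ∃ (g₁ : P ≃ₗ[R] P) (g₂ : Q ≃ₗ[R] Q),
      (∀ x : P, g x = g₁ x) ∧ ∀ x : Q, g x = g₂ x

/-- The representation `ρ` of `G` is induced from some representation of the subgroup `H`. -/
def IsInducedFrom {G K : Type*} {V : Type v} [Group G] [Field K] [AddCommGroup V] [Module K V]
    (ρ : Representation K G V) (H : Subgroup G) : Prop :=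
  ∃ (W : Type v) (_ : AddCommGroup W) (_ : Module K W) (σ : Representation K H W),
    Nonempty (ρ.Equiv (Representation.ind H.subtype σ))

end Reductions

end

end FunctorMorphing

/-!
For a non-zero left ideal `L` of `E = End_R(M)`, the quotient of `Hom_R(M, -)` by the maps whose
composites with all maps back to `M` lie in `L` is a proper subquotient, so triviality of the
morphing makes every equivariant function `E → V` that is invariant under translation by `L`
vanish. For the function `g ↦ g v` on `Eˣ`, extended by zero, this kills the Fourier coefficients
at the characters of `E` that are trivial on `L`. Hence some additive character `χ` of `E` is
trivial on no non-zero left ideal.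

By counting characters, such a `χ` bounds the size of the set of maps `M → M_i` killed by all
non-invertible maps, which amounts to `∑_j d_{ji} a_j ≤ a_i` for the numbers `d_{ji}` of arrows
of the left maximal graph. If every vertex has an outgoing arrow, summing these inequalities shows
that the arrows are those of a permutation along which `a` is constant. If some `M_i` has none,
the same bound leaves no non-zero maps between `M_i` and the other `M_j`, and `M_i ^ a_i` splits
off.

On a non-trivial cycle of the permutation let `x` be the shift. Its left ideal `I = E x` is
two-sided of square zero, so `V` decomposes into eigenspaces of the abelian group `1 + I`, with
eigencharacters trivial on no non-zero left ideal contained in `I`. Such characters of `I` are all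
conjugate under `Eˣ` to one given by a trace form, whose stabilizer is the centralizer of `x`, and
Clifford theory exhibits `V` as induced from there.
-/

namespace FunctorMorphing

noncomputable section

/-! ### Characters of finite abelian groups -/

section Characters

variable {K : Type*} [Field K] [IsAlgClosed K] [CharZero K] {B : Type*} [AddCommGroup B] [Finite B]

/-- Additive characters with values in a field, as homomorphisms to its group of units. -/
def addCharEquivUnits (B K : Type*) [AddCommGroup B] [Field K] :
    AddChar B K ≃ (Multiplicative B →* Kˣ) where
  toFun ψ := ψ.toMonoidHom.toHomUnits
  invFun φ := AddChar.toMonoidHomEquiv.symm ((Units.coeHom K).comp φ)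
  left_inv _ := rfl
  right_inv _ := by ext; rfl

variable (K B) in
lemma natCard_addChar : Nat.card (AddChar B K) = Nat.card B :=
  (Nat.card_congr (addCharEquivUnits B K)).trans
    (CommGroup.card_monoidHom_of_hasEnoughRootsOfUnity (Multiplicative B) K)

instance finite_addChar : Finite (AddChar B K) :=
  Nat.finite_of_card_ne_zero (by rw [natCard_addChar]; exact Nat.card_pos.ne')

variable (K) in
lemma exists_addChar_ne_one {x : B} (hx : x ≠ 0) : ∃ ψ : AddChar B K, ψ x ≠ 1 := by
  obtain ⟨φ, hφ⟩ := CommGroup.exists_apply_ne_one_of_hasEnoughRootsOfUnity (Multiplicative B) K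
    (a := Multiplicative.ofAdd x) (fun h => hx (Multiplicative.ofAdd.injective h))
  exact ⟨(addCharEquivUnits B K).symm φ, fun h => hφ (Units.ext h)⟩

lemma subgroup_addChar_eq_top_of_separates (S : Subgroup (AddChar B K))
    (hS : ∀ x, (∀ ψ ∈ S, ψ x = 1) → x = 0) : S = ⊤ := by
  let ev : B → (S →* Kˣ) := fun x => MonoidHom.toHomUnits
    { toFun := fun ψ => ψ.1 x, map_one' := rfl, map_mul' := fun _ _ => rfl }
  have hinj : Function.Injective ev := by
    intro x y h
    refine sub_eq_zero.1 (hS _ fun ψ hψ => ?_)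
    have hxy : ψ x = ψ y := congrArg Units.val (DFunLike.congr_fun h (⟨ψ, hψ⟩ : S))
    rw [AddChar.map_sub_eq_div, hxy, div_self (ψ.val_isUnit y).ne_zero]
  have hcard := CommGroup.card_monoidHom_of_hasEnoughRootsOfUnity S K
  have : Finite (S →* Kˣ) := Nat.finite_of_card_ne_zero (hcard ▸ Nat.card_pos.ne')
  have hle := Nat.card_le_card_of_injective ev hinj
  rw [hcard, ← natCard_addChar K B] at hle
  exact S.eq_top_of_le_card hle

lemma sum_addChar_apply_eq_zero [Fintype (AddChar B K)] {x : B} (hx : x ≠ 0) :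
    ∑ ψ : AddChar B K, ψ x = 0 := by
  obtain ⟨φ, hφ⟩ := exists_addChar_ne_one K hx
  have h : φ x * ∑ ψ : AddChar B K, ψ x = ∑ ψ : AddChar B K, ψ x := by
    rw [Finset.mul_sum]
    exact Fintype.sum_equiv (Equiv.mulLeft φ) _ _ fun ψ => rfl
  exact (mul_left_eq_self₀.1 h).resolve_left hφ

variable {V : Type*} [AddCommGroup V] [Module K V] [Fintype B]

lemma fourier_inversion [Fintype (AddChar B K)] (t : B → V) (x : B) :
    ∑ ψ : AddChar B K, ∑ y : B, ψ (y - x) • t y = (Nat.card B : K) • t x := by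
  rw [Finset.sum_comm]
  simp_rw [← Finset.sum_smul]
  rw [Finset.sum_eq_single x]
  · simp only [sub_self, AddChar.map_zero_eq_one, Finset.sum_const, Finset.card_univ, nsmul_eq_mul,
      mul_one]
    rw [← Nat.card_eq_fintype_card, natCard_addChar]
  · intro y _ hy
    rw [sum_addChar_apply_eq_zero (sub_ne_zero.2 hy), zero_smul]
  · exact fun h => absurd (Finset.mem_univ x) h

lemma eq_zero_of_fourier_eq_zero (t : B → V)
    (h : ∀ ψ : AddChar B K, ∑ y : B, ψ y • t y = 0) : t = 0 := by
  have := Fintype.ofFinite (AddChar B K)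
  funext x
  have hshift (ψ : AddChar B K) : ∑ y : B, ψ (y - x) • t y = 0 := by
    have hy (y : B) : ψ (y - x) • t y = ψ (-x) • ψ y • t y := by
      rw [smul_smul, ← AddChar.map_add_eq_mul, neg_add_eq_sub]
    simp_rw [hy, ← Finset.smul_sum, h, smul_zero]
  have hinv := fourier_inversion (K := K) t x
  simp_rw [hshift, Finset.sum_const_zero] at hinv
  exact (smul_eq_zero.1 hinv.symm).resolve_left (Nat.cast_ne_zero.2 Nat.card_pos.ne')

end Characters

/-! ### Primitive representations of unit groups -/

section Primitive

variable {E : Type*} [Ring E] {K : Type*} [Field K] {V : Type*} [AddCommGroup V] [Module K V]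
  {ρ : Representation K Eˣ V}

/-- A representation of `Eˣ` is primitive if it admits no non-zero equivariant function from `E`
that is invariant under translations by a non-zero left ideal. For one-dimensional representations
of `(ℤ/n)ˣ` these are the primitive Dirichlet characters; for `E = End(M)` the condition excludes
the quotients of the functor `Hom(M, -)` by left ideals. -/
def IsPrimitiveRep (ρ : Representation K Eˣ V) : Prop :=
  ∀ L : Ideal E, L ≠ ⊥ → ∀ t : E → V, (∀ (g : Eˣ) e, t (g * e) = ρ g (t e)) →
    (∀ e, ∀ l ∈ L, t (e + l) = t e) → t = 0

open Classical in
/-- The orbit map `g ↦ ρ g v` of the units, extended by zero to all of `E`. -/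
def orbitFun (ρ : Representation K Eˣ V) (v : V) (e : E) : V :=
  if h : IsUnit e then ρ h.unit v else 0

@[simp] lemma orbitFun_coe (v : V) (g : Eˣ) : orbitFun ρ v g = ρ g v := by
  rw [orbitFun, dif_pos g.isUnit, IsUnit.unit_of_val_units]

lemma orbitFun_of_not_isUnit (v : V) {e : E} (he : ¬ IsUnit e) : orbitFun ρ v e = 0 :=
  dif_neg he

lemma orbitFun_mul (v : V) (g : Eˣ) (e : E) : orbitFun ρ v (g * e) = ρ g (orbitFun ρ v e) := by
  by_cases he : IsUnit e
  · obtain ⟨h, rfl⟩ := he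
    rw [← Units.val_mul, orbitFun_coe, orbitFun_coe, map_mul, Module.End.mul_apply]
  · rw [orbitFun_of_not_isUnit v he, orbitFun_of_not_isUnit v (by rwa [Units.isUnit_units_mul]),
      map_zero]

lemma eq_zero_of_orbitFun_eq_zero {v : V} (h : orbitFun ρ v = 0) : v = 0 := by
  simpa only [orbitFun_coe, Units.val_one, map_one, Module.End.one_apply, Pi.zero_apply] using
    (orbitFun_coe (ρ := ρ) v 1).symm.trans (congrFun h _)

lemma exists_add_eq_units_mul {L : Ideal E} (hunit : ∀ l ∈ L, IsUnit (1 + l)) (g : Eˣ) {l : E}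
    (hl : l ∈ L) : ∃ h : Eˣ, (h : E) - 1 ∈ L ∧ (g : E) + l = (g * h : Eˣ) := by
  have hl' : (↑g⁻¹ : E) * l ∈ L := L.mul_mem_left _ hl
  obtain ⟨h, hh⟩ := hunit _ hl'
  refine ⟨h, by rwa [hh, add_sub_cancel_left], ?_⟩
  rw [Units.val_mul, hh, mul_add, mul_one, Units.mul_inv_cancel_left]

lemma IsPrimitiveRep.eq_zero_of_fixed_one_add (hρ : IsPrimitiveRep ρ) {L : Ideal E} (hL : L ≠ ⊥)
    (hunit : ∀ l ∈ L, IsUnit (1 + l)) {v : V} (hv : ∀ g : Eˣ, (g : E) - 1 ∈ L → ρ g v = v) :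
    v = 0 := by
  refine eq_zero_of_orbitFun_eq_zero (hρ L hL _ (orbitFun_mul v) fun e l hl => ?_)
  by_cases he : IsUnit e
  · obtain ⟨g, rfl⟩ := he
    obtain ⟨h, hh, hgl⟩ := exists_add_eq_units_mul hunit g hl
    rw [hgl, orbitFun_coe, orbitFun_coe, map_mul, Module.End.mul_apply, hv h hh]
  · have hel : ¬ IsUnit (e + l) := by
      rintro ⟨g, hg⟩
      obtain ⟨h, -, hgl⟩ := exists_add_eq_units_mul hunit g (L.neg_mem hl)
      rw [hg, add_neg_cancel_right] at hgl
      exact he (hgl ▸ Units.isUnit _)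
    rw [orbitFun_of_not_isUnit v he, orbitFun_of_not_isUnit v hel]

variable (E) in
/-- A character of an `E`-module is generating if its kernel contains no non-zero submodule. A
finite ring which has a generating character as a left module over itself is a Frobenius ring. -/
def IsGeneratingChar {N : Type*} [AddCommGroup N] [Module E N] (χ : AddChar N K) : Prop :=
  ∀ u, (∀ s : E, χ (s • u) = 1) → u = 0

lemma IsPrimitiveRep.sum_orbitFun_add_eq_zero (hρ : IsPrimitiveRep ρ) {L : Ideal E} [Fintype L]
    (hL : L ≠ ⊥) (v : V) (e : E) : ∑ l : L, orbitFun ρ v (e + l) = 0 := by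
  refine congrFun (hρ L hL (fun e => ∑ l : L, orbitFun ρ v (e + l)) (fun g e => ?_)
    fun e l hl => ?_) e
  · rw [map_sum]
    simp_rw [← orbitFun_mul]
    refine Fintype.sum_equiv ((Units.mulLeft g⁻¹).subtypeEquiv fun l => ?_) _ _ fun l => ?_
    · exact (Submodule.smul_mem_iff_of_isUnit L g⁻¹.isUnit).symm
    · change orbitFun ρ v (g * e + l) = orbitFun ρ v (g * (e + ↑g⁻¹ * l))
      rw [mul_add, Units.mul_inv_cancel_left]
  · exact Fintype.sum_equiv (Equiv.addLeft (⟨l, hl⟩ : L)) _ _ fun l' => by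
      rw [add_assoc]; rfl

lemma IsPrimitiveRep.exists_isGeneratingChar [IsAlgClosed K] [CharZero K] [Finite E] [Nontrivial V]
    (hρ : IsPrimitiveRep ρ) : ∃ χ : AddChar E K, IsGeneratingChar E χ := by
  obtain ⟨v, hv⟩ := exists_ne (0 : V)
  by_contra! hcon
  have := Fintype.ofFinite E
  refine hv (eq_zero_of_orbitFun_eq_zero (ρ := ρ) ?_)
  refine eq_zero_of_fourier_eq_zero (K := K) _ fun χ => ?_
  obtain ⟨u, hχ, hu⟩ : ∃ u : E, (∀ s : E, χ (s • u) = 1) ∧ u ≠ 0 := by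
    simpa only [IsGeneratingChar, not_forall, exists_prop] using hcon χ
  let L : Ideal E := Ideal.span {u}
  have hL : L ≠ ⊥ := mt Ideal.span_singleton_eq_bot.1 hu
  have hχL (l : L) : χ l = 1 := by
    obtain ⟨s, hs⟩ := Ideal.mem_span_singleton'.1 l.2
    rw [← hs, ← smul_eq_mul, hχ]
  have := Fintype.ofFinite L
  have hshift (l : L) :
      ∑ e, χ e • orbitFun ρ v (e + l) = ∑ e, χ e • orbitFun ρ v e :=
    Fintype.sum_equiv (Equiv.addRight l.1) _ _ fun e => by
      rw [Equiv.coe_addRight, AddChar.map_add_eq_mul, hχL, mul_one]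
  have havg : ∑ l : L, ∑ e, χ e • orbitFun ρ v (e + l) = 0 := by
    rw [Finset.sum_comm]
    simp only [← Finset.smul_sum, hρ.sum_orbitFun_add_eq_zero hL, smul_zero, Finset.sum_const_zero]
  simp only [hshift, Finset.sum_const, Finset.card_univ, ← Nat.cast_smul_eq_nsmul K] at havg
  exact (smul_eq_zero.1 havg).resolve_left (Nat.cast_ne_zero.2 Fintype.card_ne_zero)

end Primitive

/-! ### Induction from the stabilizer of a character -/

section Induced

open Representation

variable {G K : Type*} {V : Type v} [Group G] [Field K] [AddCommGroup V] [Module K V]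
  {ρ : Representation K G V} {H : Subgroup G}

lemma indV_mk_mul_apply {S U : Type*} [Group S] [AddCommGroup U] [Module K U] (φ : S →* G)
    (σ : Representation K S U) (s : S) (g : G) (x : U) :
    IndV.mk φ σ (φ s * g) (σ s x) = IndV.mk φ σ g x := by
  simpa [IndV.mk] using Coinvariants.mk_self_apply
    (tprod ((leftRegular K G).comp φ) σ) s (TensorProduct.tmul K (MonoidAlgebra.single g 1) x)

/-- The map `g ⊗ x ↦ ρ g⁻¹ x` from the representation induced from an `H`-stable subspace. -/
def ofIndV (W : Subrepresentation (ρ.comp H.subtype)) :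
    IndV H.subtype W.toRepresentation →ₗ[K] V :=
  Coinvariants.lift _
    (TensorProduct.lift <|
      (Finsupp.lift _ _ _ fun g : G => ρ g⁻¹ ∘ₗ W.toSubmodule.subtype) ∘ₗ
        (MonoidAlgebra.coeffLinearEquiv K).toLinearMap)
    fun h => by
      ext g x
      simp [Subrepresentation.toRepresentation]

/-- Sums of representatives `q⁻¹ ⊗ x`, one for each coset. -/
def cosetSum (W : Subrepresentation (ρ.comp H.subtype)) :
    (G ⧸ H →₀ W.toSubmodule) →ₗ[K] IndV H.subtype W.toRepresentation :=
  Finsupp.lsum K fun q => IndV.mk H.subtype W.toRepresentation q.out⁻¹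

variable (W : Subrepresentation (ρ.comp H.subtype))

lemma ofIndV_mk (g : G) (x : W.toSubmodule) :
    ofIndV W (IndV.mk H.subtype W.toRepresentation g x) = ρ g⁻¹ x := by
  simp [ofIndV]

lemma ofIndV_ind (g : G) (z : IndV H.subtype W.toRepresentation) :
    ofIndV W (ind H.subtype W.toRepresentation g z) = ρ g (ofIndV W z) := by
  suffices ofIndV W ∘ₗ ind H.subtype W.toRepresentation g = ρ g ∘ₗ ofIndV W from
    DFunLike.congr_fun this z
  refine IndV.hom_ext _ _ fun g' => LinearMap.ext fun x => ?_
  change ofIndV W (ind _ _ g (IndV.mk _ _ g' x)) = ρ g (ofIndV W (IndV.mk _ _ g' x))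
  rw [ind_mk, ofIndV_mk, ofIndV_mk, mul_inv_rev, inv_inv, map_mul, Module.End.mul_apply]

lemma cosetSum_surjective : Function.Surjective (cosetSum W) := by
  rw [← LinearMap.range_eq_top, ← Submodule.ker_mkQ (LinearMap.range _), LinearMap.ker_eq_top]
  refine IndV.hom_ext _ _ fun g => LinearMap.ext fun x =>
    (Submodule.Quotient.mk_eq_zero _).2 ?_
  obtain ⟨h, hh⟩ := QuotientGroup.mk_out_eq_mul H g⁻¹
  refine ⟨Finsupp.single (QuotientGroup.mk g⁻¹) (W.toRepresentation h⁻¹ x), ?_⟩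
  rw [cosetSum, Finsupp.lsum_single, hh, mul_inv_rev, inv_inv]
  exact indV_mk_mul_apply H.subtype _ h⁻¹ g x

lemma projection_ofIndV_cosetSum {P : V →ₗ[K] V} (hP : ∀ x ∈ W.toSubmodule, P x = x)
    (hP' : ∀ g ∉ H, ∀ x ∈ W.toSubmodule, P (ρ g x) = 0) (t : G ⧸ H →₀ W.toSubmodule) (q : G ⧸ H) :
    P (ρ q.out⁻¹ (ofIndV W (cosetSum W t))) = t q := by
  suffices P ∘ₗ ρ q.out⁻¹ ∘ₗ ofIndV W ∘ₗ cosetSum W =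
      W.toSubmodule.subtype ∘ₗ Finsupp.lapply q from DFunLike.congr_fun this t
  classical
  refine Finsupp.lhom_ext fun q' x => ?_
  change P (ρ q.out⁻¹ (ofIndV W (cosetSum W (.single q' x)))) = Finsupp.single q' x q
  rw [cosetSum, Finsupp.lsum_single, ofIndV_mk, inv_inv, Finsupp.single_apply,
    ← Module.End.mul_apply (ρ _), ← map_mul]
  split_ifs with hq
  · rw [hq, inv_mul_cancel, map_one, Module.End.one_apply, hP _ x.2]
  · refine hP' _ (fun hmem => hq ?_) _ x.2
    rw [← QuotientGroup.out_eq' q, ← QuotientGroup.out_eq' q', QuotientGroup.eq.2 hmem]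

lemma ofIndV_injective {P : V →ₗ[K] V} (hP : ∀ x ∈ W.toSubmodule, P x = x)
    (hP' : ∀ g ∉ H, ∀ x ∈ W.toSubmodule, P (ρ g x) = 0) : Function.Injective (ofIndV W) := by
  rw [injective_iff_map_eq_zero]
  intro z hz
  obtain ⟨t, rfl⟩ := cosetSum_surjective W z
  have ht : t = 0 := by
    ext q
    rw [← projection_ofIndV_cosetSum W hP hP' t q, hz, map_zero, map_zero, Finsupp.zero_apply,
      ZeroMemClass.coe_zero]
  rw [ht, map_zero]

/-- The projection `P` shows that the translates of `W` over distinct cosets of `H` are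
independent. -/
lemma isInducedFrom_of_projection (hspan : ⨆ g, W.toSubmodule.map (ρ g) = ⊤) {P : V →ₗ[K] V}
    (hP : ∀ x ∈ W.toSubmodule, P x = x) (hP' : ∀ g ∉ H, ∀ x ∈ W.toSubmodule, P (ρ g x) = 0) :
    IsInducedFrom ρ H := by
  have hsurj : Function.Surjective (ofIndV W) := by
    rw [← LinearMap.range_eq_top, eq_top_iff, ← hspan]
    refine iSup_le fun g => ?_
    rintro _ ⟨x, hx, rfl⟩
    exact ⟨IndV.mk H.subtype W.toRepresentation g⁻¹ ⟨x, hx⟩, by rw [ofIndV_mk, inv_inv]⟩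
  let e := LinearEquiv.ofBijective (ofIndV W) ⟨ofIndV_injective W hP hP', hsurj⟩
  exact ⟨W.toSubmodule, inferInstance, inferInstance, W.toRepresentation,
    ⟨(Representation.Equiv.mk e fun g => LinearMap.ext (ofIndV_ind W g)).symm⟩⟩

end Induced

section Clifford

variable {G K : Type*} {V : Type v} [Group G] [Field K] [AddCommGroup V] [Module K V]
  {ρ : Representation K G V} {B : Type*} [AddCommGroup B]

/-- The subspace on which an abelian group acting through `c : B → G` acts by the character `χ`. -/
def charSpace (ρ : Representation K G V) (c : Multiplicative B →* G) (χ : AddChar B K) :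
    Submodule K V :=
  ⨅ u : B, Module.End.eigenspace (ρ (c (.ofAdd u))) (χ u)

variable {c : Multiplicative B →* G} {χ : AddChar B K}

lemma mem_charSpace {x : V} : x ∈ charSpace ρ c χ ↔ ∀ u, ρ (c (.ofAdd u)) x = χ u • x := by
  simp only [charSpace, Submodule.mem_iInf, Module.End.mem_eigenspace_iff]

lemma apply_mem_charSpace {act : G → B →+ B}
    (hact : ∀ g u, c (.ofAdd (act g u)) = g * c (.ofAdd u) * g⁻¹) (g : G) {x : V}
    (hx : x ∈ charSpace ρ c χ) : ρ g x ∈ charSpace ρ c (χ.compAddMonoidHom (act g⁻¹)) := by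
  rw [mem_charSpace] at hx ⊢
  intro u
  rw [AddChar.compAddMonoidHom_apply, ← map_smul, ← hx, hact, inv_inv, ← Module.End.mul_apply,
    ← Module.End.mul_apply, ← map_mul, ← map_mul, mul_assoc, mul_inv_cancel_left]

lemma exists_mem_charSpace_ne_zero [IsAlgClosed K] [CharZero K] [Finite B] [Nontrivial V]
    (ρ : Representation K G V) (c : Multiplicative B →* G) :
    ∃ χ : AddChar B K, ∃ x ∈ charSpace ρ c χ, x ≠ 0 := by
  have := Fintype.ofFinite B
  obtain ⟨x, hx⟩ := exists_ne (0 : V)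
  obtain ⟨χ, hχ⟩ : ∃ χ : AddChar B K, ∑ u, χ u • ρ (c (.ofAdd u)) x ≠ 0 := by
    by_contra! hcon
    refine hx ?_
    simpa using congrFun (eq_zero_of_fourier_eq_zero (fun u => ρ (c (.ofAdd u)) x) hcon) 0
  refine ⟨χ⁻¹, _, mem_charSpace.2 fun w => ?_, hχ⟩
  rw [map_sum, Finset.smul_sum]
  refine Fintype.sum_equiv (Equiv.addRight w) _ _ fun u => ?_
  rw [Equiv.coe_addRight, map_smul, ← Module.End.mul_apply, ← map_mul, ← map_mul, ← ofAdd_add,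
    smul_smul, AddChar.inv_apply, ← AddChar.map_add_eq_mul, add_comm w u,
    neg_add_cancel_comm_assoc]

/-- The averaging operator projecting onto `charSpace ρ c χ`. -/
def charProj [Fintype B] (ρ : Representation K G V) (c : Multiplicative B →* G)
    (χ : AddChar B K) : V →ₗ[K] V :=
  (Fintype.card B : K)⁻¹ • ∑ u, χ (-u) • ρ (c (.ofAdd u))

lemma charProj_apply_of_mem [Fintype B] {χ' : AddChar B K} {x : V}
    (hx : x ∈ charSpace ρ c χ') :
    charProj ρ c χ x = ((Fintype.card B : K)⁻¹ * ∑ u, (χ' * χ⁻¹) u) • x := by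
  rw [charProj, LinearMap.smul_apply, LinearMap.sum_apply, mul_smul, Finset.sum_smul]
  refine congrArg _ (Finset.sum_congr rfl fun u _ => ?_)
  rw [LinearMap.smul_apply, mem_charSpace.1 hx, smul_smul, AddChar.mul_apply, AddChar.inv_apply,
    mul_comm]

lemma charProj_apply_of_mem_self [CharZero K] [Fintype B] {x : V} (hx : x ∈ charSpace ρ c χ) :
    charProj ρ c χ x = x := by
  rw [charProj_apply_of_mem hx, mul_inv_cancel,
    Fintype.sum_congr _ _ AddChar.one_apply, Finset.sum_const, Finset.card_univ, nsmul_one,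
    inv_mul_cancel₀ (Nat.cast_ne_zero.2 Fintype.card_ne_zero), one_smul]

lemma charProj_apply_of_mem_ne [CharZero K] [Fintype B] {χ' : AddChar B K} {x : V}
    (hx : x ∈ charSpace ρ c χ') (h : χ' ≠ χ) : charProj ρ c χ x = 0 := by
  have hne : χ' * χ⁻¹ ≠ 0 := mt mul_inv_eq_one.1 h
  rw [charProj_apply_of_mem hx, AddChar.sum_eq_zero_iff_ne_zero.2 hne, mul_zero, zero_smul]

lemma nontrivial_of_isIrreducible (hρ : ρ.IsIrreducible) : Nontrivial V := by
  by_contra! h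
  exact bot_ne_top (α := Subrepresentation ρ)
    (Subrepresentation.toSubmodule_injective (Subsingleton.elim _ _))

lemma iSup_map_eq_top_of_isIrreducible (hρ : ρ.IsIrreducible) {W : Submodule K V} (hW : W ≠ ⊥) :
    ⨆ g, W.map (ρ g) = ⊤ := by
  let U : Subrepresentation ρ := ⟨⨆ g, W.map (ρ g), fun g x hx => by
    suffices (⨆ g, W.map (ρ g)) ≤ (⨆ g, W.map (ρ g)).comap (ρ g) from this hx
    refine iSup_le fun g' => ?_
    rintro _ ⟨y, hy, rfl⟩
    refine Submodule.mem_iSup_of_mem (g * g') ⟨y, hy, ?_⟩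
    rw [map_mul, Module.End.mul_apply]⟩
  have hWU : W ≤ U.toSubmodule := fun x hx => Submodule.mem_iSup_of_mem 1 ⟨x, hx, by simp⟩
  have hU : U ≠ ⊥ := fun h => hW (le_bot_iff.1 (hWU.trans_eq (congrArg _ h)))
  exact congrArg Subrepresentation.toSubmodule ((eq_bot_or_eq_top U).resolve_left hU)

lemma isInducedFrom_of_charSpace_ne_bot [CharZero K] [Finite B] (hρ : ρ.IsIrreducible)
    {act : G → B →+ B} (hact : ∀ g u, c (.ofAdd (act g u)) = g * c (.ofAdd u) * g⁻¹)
    {H : Subgroup G} (hH : ∀ g, g ∈ H ↔ ∀ u, χ (act g u) = χ u) (hχ : charSpace ρ c χ ≠ ⊥) :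
    IsInducedFrom ρ H := by
  have := Fintype.ofFinite B
  have hHχ (g : G) : g ∈ H ↔ χ.compAddMonoidHom (act g⁻¹) = χ := by
    rw [← inv_mem_iff, hH, DFunLike.ext_iff]
    rfl
  let W : Subrepresentation (ρ.comp H.subtype) :=
    ⟨charSpace ρ c χ, fun h x hx => by
      have hmem := apply_mem_charSpace hact (h : G) hx
      rwa [(hHχ h).1 h.2] at hmem⟩
  exact isInducedFrom_of_projection W (iSup_map_eq_top_of_isIrreducible hρ hχ)
    (fun x hx => charProj_apply_of_mem_self hx)
    fun g hg x hx => charProj_apply_of_mem_ne (apply_mem_charSpace hact g hx) (mt (hHχ g).2 hg)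

end Clifford

/-! ### Generating characters of a principal ideal of square zero -/

section TraceCharacter

variable {E K : Type*} [Ring E] [Field K]

/-- The restriction of an additive character to a left ideal. -/
def restrictIdeal (χ : AddChar E K) (I : Ideal E) : AddChar I K :=
  χ.compAddMonoidHom (I.subtype : I →ₗ[E] E).toAddMonoidHom

@[simp] lemma restrictIdeal_apply (χ : AddChar E K) (I : Ideal E) (u : I) :
    restrictIdeal χ I u = χ u := rfl

lemma IsGeneratingChar.exists_eq_smul [IsAlgClosed K] [CharZero K] {N : Type*} [AddCommGroup N]
    [Module E N] [Finite N] {χ : AddChar N K} (hχ : IsGeneratingChar E χ) (χ' : AddChar N K) :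
    ∃ s : E, ∀ u, χ' u = χ (s • u) := by
  let S : Subgroup (AddChar N K) :=
    { carrier := {ψ | ∃ s : E, ∀ u, ψ u = χ (s • u)}
      one_mem' := ⟨0, fun u => by rw [zero_smul, AddChar.map_zero_eq_one, AddChar.one_apply]⟩
      mul_mem' := by
        rintro ψ ψ' ⟨s, hs⟩ ⟨s', hs'⟩
        exact ⟨s + s', fun u => by
          rw [AddChar.mul_apply, hs, hs', add_smul, AddChar.map_add_eq_mul]⟩
      inv_mem' := by
        rintro ψ ⟨s, hs⟩
        exact ⟨-s, fun u => by rw [AddChar.inv_apply, hs, smul_neg, neg_smul]⟩ }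
  have hS : S = ⊤ := subgroup_addChar_eq_top_of_separates S fun u hu =>
    hχ u fun s => hu (χ.compAddMonoidHom (DistribSMul.toAddMonoidHom N s)) ⟨s, fun _ => rfl⟩
  exact (hS ▸ Subgroup.mem_top χ' : χ' ∈ S)

/-- The left ideal `E x` is two-sided, and `χ` restricts to a non-degenerate trace form
`s x ↦ χ (s x)` on it. -/
structure IsTraceCharacter (x : E) (χ : AddChar E K) : Prop where
  mul_mem : ∀ t, x * t ∈ Ideal.span {x}
  trace : ∀ s t, χ (s * t * x) = χ (t * s * x)
  isGeneratingChar : IsGeneratingChar E (restrictIdeal χ (Ideal.span {x}))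

variable {x : E} {χ₀ : AddChar E K}

lemma isTwoSided_span (h : ∀ t, x * t ∈ Ideal.span {x}) : (Ideal.span {x}).IsTwoSided := by
  refine ⟨fun {a} t ha => ?_⟩
  obtain ⟨s, rfl⟩ := Ideal.mem_span_singleton'.1 ha
  rw [mul_assoc]
  exact Ideal.mul_mem_left _ _ (h t)

lemma IsTraceCharacter.mul_eq_mul (h : IsTraceCharacter x χ₀) {w w' : E}
    (hw : ∀ s, χ₀ (s * (w * x)) = χ₀ (s * (w' * x))) : w * x = w' * x := by
  have hmem : w * x - w' * x ∈ Ideal.span {x} :=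
    Ideal.mem_span_singleton'.2 ⟨w - w', sub_mul w w' x⟩
  have hzero := h.isGeneratingChar ⟨_, hmem⟩ fun s => by
    rw [restrictIdeal_apply, Submodule.coe_smul, smul_eq_mul, mul_sub, AddChar.map_sub_eq_div,
      hw, div_self (χ₀.val_isUnit _).ne_zero]
  exact sub_eq_zero.1 (congrArg Subtype.val hzero)

lemma IsTraceCharacter.forall_conj_eq_iff_commute (h : IsTraceCharacter x χ₀) (g : Eˣ) :
    (∀ u ∈ Ideal.span {x}, χ₀ (g * u * (g⁻¹ : Eˣ)) = χ₀ u) ↔ Commute (g : E) x := by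
  constructor
  · intro hg
    obtain ⟨γ, hγ⟩ := Ideal.mem_span_singleton'.1 (h.mul_mem (g⁻¹ : Eˣ))
    have hconj : g * x * (g⁻¹ : Eˣ) = (g * γ : E) * x := by rw [mul_assoc, ← hγ, mul_assoc]
    have hfix : (g * γ : E) * x = 1 * x := h.mul_eq_mul fun s => by
      have hs := hg ((g⁻¹ : Eˣ) * (s * g) * x)
        (Ideal.mul_mem_left _ _ (Ideal.mem_span_singleton_self x))
      rw [h.trace] at hs
      simpa only [← hconj, mul_assoc, Units.mul_inv_cancel_left, Units.mul_inv, one_mul,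
        Units.inv_mul_cancel_left] using hs
    rw [one_mul, ← hconj] at hfix
    exact (Units.mul_inv_eq_iff_eq_mul g).1 hfix
  · intro hg u hu
    obtain ⟨s, rfl⟩ := Ideal.mem_span_singleton'.1 hu
    have hgx : (g * (s * x) * (g⁻¹ : Eˣ) : E) = g * (s * (g⁻¹ : Eˣ)) * x := by
      simp only [mul_assoc, (hg.units_inv_left).eq]
    rw [hgx, h.trace, Units.inv_mul_cancel_right]

/-- If `χ (u) = χ₀ (s u)` and `χ₀ (u) = χ (s' u)` on `E x`, then `s` and `s'` act on `E x` as
mutually inverse operators, and conjugating `x` to `s' x` conjugates `χ₀` to `χ`. -/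
lemma IsTraceCharacter.exists_conj [IsAlgClosed K] [CharZero K] [Finite E]
    (h : IsTraceCharacter x χ₀)
    (hconj : ∀ y : E, Ideal.span {y} = Ideal.span {x} → ∃ g : Eˣ, SemiconjBy (g : E) x y)
    {χ : AddChar (Ideal.span {x}) K} (hχ : IsGeneratingChar E χ) :
    ∃ g : Eˣ, ∀ u : Ideal.span {x}, χ u = χ₀ ((g⁻¹ : Eˣ) * u * g) := by
  obtain ⟨s, hs⟩ := h.isGeneratingChar.exists_eq_smul χ
  obtain ⟨s', hs'⟩ := hχ.exists_eq_smul (restrictIdeal χ₀ (Ideal.span {x}))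
  have hss : (s * s') * x = 1 * x := h.mul_eq_mul fun t => by
    have ht := hs' ⟨t * x, Ideal.mul_mem_left _ _ (Ideal.mem_span_singleton_self x)⟩
    rw [hs] at ht
    simp only [restrictIdeal_apply, Submodule.coe_smul, smul_eq_mul] at ht
    rw [one_mul, ht, ← mul_assoc, h.trace]
    simp only [mul_assoc]
  rw [one_mul, mul_assoc] at hss
  obtain ⟨g, hg⟩ := hconj (s' * x) <| le_antisymm
    ((Ideal.span_singleton_le_iff_mem _).2 (Ideal.mem_span_singleton'.2 ⟨s', rfl⟩))
    ((Ideal.span_singleton_le_iff_mem _).2 (Ideal.mem_span_singleton'.2 ⟨s, hss⟩))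
  have hxg : x * g = (s * g : E) * x := by rw [mul_assoc, hg.eq, ← mul_assoc, hss]
  refine ⟨g, fun u => ?_⟩
  obtain ⟨w, hw⟩ := Ideal.mem_span_singleton'.1 u.2
  have hu : ((g⁻¹ : Eˣ) * (w * x) * g : E) = (g⁻¹ : Eˣ) * (w * s * g) * x := by
    simp only [mul_assoc, hxg]
  rw [hs, restrictIdeal_apply, Submodule.coe_smul, smul_eq_mul, ← hw, hu, h.trace,
    Units.mul_inv_cancel_right, ← mul_assoc, h.trace]

end TraceCharacter

section SquareZero

variable {E : Type*} [Ring E] {I : Ideal E}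

/-- The homomorphism `u ↦ 1 + u` from an ideal of square zero to the units. -/
def oneAddHom (hI : ∀ u ∈ I, ∀ w ∈ I, u * w = 0) : Multiplicative I →* Eˣ :=
  MonoidHom.toHomUnits
    { toFun := fun u => 1 + (u.toAdd : E)
      map_one' := add_zero 1
      map_mul' := fun u w => by
        have huw := hI _ u.toAdd.2 _ w.toAdd.2
        rw [toAdd_mul, Submodule.coe_add, mul_add, mul_one, add_mul, one_mul, huw, add_zero,
          add_assoc] }

lemma coe_oneAddHom (hI : ∀ u ∈ I, ∀ w ∈ I, u * w = 0) (u : I) :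
    (oneAddHom hI (.ofAdd u) : E) = 1 + u := rfl

/-- Conjugation by a unit on a two-sided ideal. -/
def conjIdeal (I : Ideal E) [I.IsTwoSided] (g : Eˣ) : I →+ I where
  toFun u := ⟨g * u * (g⁻¹ : Eˣ), I.mul_mem_right _ (I.mul_mem_left _ u.2)⟩
  map_zero' := Subtype.ext (by simp)
  map_add' u w := Subtype.ext (by simp [mul_add, add_mul])

lemma coe_conjIdeal [I.IsTwoSided] (g : Eˣ) (u : I) :
    (conjIdeal I g u : E) = g * u * (g⁻¹ : Eˣ) := rfl

lemma oneAddHom_conjIdeal (hI : ∀ u ∈ I, ∀ w ∈ I, u * w = 0) [I.IsTwoSided] (g : Eˣ) (u : I) :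
    oneAddHom hI (.ofAdd (conjIdeal I g u)) = g * oneAddHom hI (.ofAdd u) * g⁻¹ :=
  Units.ext <| by
    simp only [Units.val_mul, coe_oneAddHom, coe_conjIdeal, mul_add, add_mul, mul_one,
      Units.mul_inv]

end SquareZero

section Induction

variable {E G K : Type*} [Ring E] [Group G] [Field K] {V : Type v} [AddCommGroup V]
  [Module K V] {ρ : Representation K G V} (e : Eˣ ≃* G)

lemma isGeneratingChar_of_mem_charSpace {I : Ideal E} (hI : ∀ u ∈ I, ∀ w ∈ I, u * w = 0)
    (hprim : IsPrimitiveRep (ρ.comp e.toMonoidHom)) {χ : AddChar I K} {y : V}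
    (hy : y ∈ charSpace ρ (e.toMonoidHom.comp (oneAddHom hI)) χ) (hy0 : y ≠ 0) :
    IsGeneratingChar E χ := by
  intro u hu
  by_contra hu0
  have hL : Ideal.span {(u : E)} ≠ ⊥ := by
    rwa [Ne, Ideal.span_singleton_eq_bot, ZeroMemClass.coe_eq_zero]
  have hLI : Ideal.span {(u : E)} ≤ I := (Ideal.span_singleton_le_iff_mem I).2 u.2
  refine hy0 (hprim.eq_zero_of_fixed_one_add hL (fun l hl => ?_) fun g hg => ?_)
  · exact ⟨oneAddHom hI (.ofAdd ⟨l, hLI hl⟩), rfl⟩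
  · obtain ⟨s, hs⟩ := Ideal.mem_span_singleton'.1 hg
    have hg : g = oneAddHom hI (.ofAdd (s • u)) := Units.ext <| by
      rw [coe_oneAddHom, Submodule.coe_smul, smul_eq_mul, hs, add_sub_cancel]
    have hχ := mem_charSpace.1 hy (s • u)
    rwa [hu, one_smul, MonoidHom.comp_apply, ← hg] at hχ

theorem isInducedFrom_of_isTraceCharacter [IsAlgClosed K] [CharZero K] [Finite E]
    (hρ : ρ.IsIrreducible) (hprim : IsPrimitiveRep (ρ.comp e.toMonoidHom)) {x : E}
    (hxx : x * x = 0) {χ₀ : AddChar E K} (hχ₀ : IsTraceCharacter x χ₀)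
    (hconj : ∀ y : E, Ideal.span {y} = Ideal.span {x} → ∃ g : Eˣ, SemiconjBy (g : E) x y)
    {H : Subgroup G} (hH : ∀ g, g ∈ H ↔ Commute (e.symm g : E) x) : IsInducedFrom ρ H := by
  let I : Ideal E := Ideal.span {x}
  have hI₂ : I.IsTwoSided := isTwoSided_span hχ₀.mul_mem
  have hI : ∀ u ∈ I, ∀ w ∈ I, u * w = 0 := by
    intro u hu w hw
    obtain ⟨s, rfl⟩ := Ideal.mem_span_singleton'.1 hu
    obtain ⟨t, rfl⟩ := Ideal.mem_span_singleton'.1 hw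
    obtain ⟨t', ht'⟩ := Ideal.mem_span_singleton'.1 (hχ₀.mul_mem t)
    rw [mul_assoc, ← mul_assoc x, ← ht', mul_assoc t', hxx, mul_zero, mul_zero]
  have hact (g : G) (u : I) : e (oneAddHom hI (.ofAdd (conjIdeal I (e.symm g) u))) =
      g * e (oneAddHom hI (.ofAdd u)) * g⁻¹ := by
    rw [oneAddHom_conjIdeal, map_mul, map_mul, map_inv, e.apply_symm_apply]
  have := nontrivial_of_isIrreducible hρ
  obtain ⟨χ, y, hy, hy0⟩ := exists_mem_charSpace_ne_zero ρ (e.toMonoidHom.comp (oneAddHom hI))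
  obtain ⟨g, hg⟩ := hχ₀.exists_conj hconj (isGeneratingChar_of_mem_charSpace e hI hprim hy hy0)
  have hχ : χ.compAddMonoidHom (conjIdeal I g) = restrictIdeal χ₀ I := by
    ext u
    rw [AddChar.compAddMonoidHom_apply, hg, coe_conjIdeal]
    simp only [mul_assoc, Units.inv_mul_cancel_left, Units.inv_mul, mul_one, restrictIdeal_apply]
  refine isInducedFrom_of_charSpace_ne_bot (c := e.toMonoidHom.comp (oneAddHom hI))
    (χ := restrictIdeal χ₀ I) hρ hact (fun g => ?_) ?_
  · rw [hH, ← hχ₀.forall_conj_eq_iff_commute, Subtype.forall]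
    rfl
  · have hmem := apply_mem_charSpace hact (e g⁻¹) hy
    rw [← map_inv, inv_inv, e.symm_apply_apply, hχ] at hmem
    refine (Submodule.ne_bot_iff _).2 ⟨_, hmem, fun h => hy0 ?_⟩
    simpa using congrArg (ρ (e g)) h

end Induction

/-! ### Quotients of `Hom(M, -)` by left ideals of `End(M)` -/

section QuotientFunctor

variable (A : Type w) [CommRing A] {R : Type u} [Ring R] [Algebra A R]
  {ι : Type} {N : ι → Type v} [∀ i, AddCommGroup (N i)] [∀ i, Module R (N i)] {a : ι → ℕ}
  (L : Ideal (Module.End R (BigModule N a)))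

/-- The value at `X` of the subfunctor of `Hom(M, -)` whose value at `M` is the left ideal `L`. -/
def idealSub (X : SumCat R N) : Submodule A (bigObj R N a ⟶ X) where
  carrier := {h | ∀ r : X ⟶ bigObj R N a, ((h ≫ r).hom.hom : Module.End R (BigModule N a)) ∈ L}
  zero_mem' r := by
    rw [Limits.zero_comp]
    exact L.zero_mem
  add_mem' {h h'} hh hh' r := by
    rw [Preadditive.add_comp]
    exact L.add_mem (hh r) (hh' r)
  smul_mem' c h hh r := by
    rw [Linear.smul_comp, ← Linear.comp_smul]
    exact hh (c • r)

lemma mem_idealSub_bigHom (e : Module.End R (BigModule N a)) :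
    (bigHom R N a e ∈ idealSub A L (bigObj R N a)) ↔ e ∈ L := by
  refine ⟨fun h => h (𝟙 _), fun h r => ?_⟩
  exact L.mul_mem_left (r.hom.hom : Module.End R (BigModule N a)) h

/-- The quotient of the functor `Hom(M, -)` by the subfunctor generated by a left ideal of
`End(M)`. -/
def quotientFunctor : FunCat A R N where
  obj :=
    { obj := fun X => ModuleCat.of A ((bigObj R N a ⟶ X) ⧸ idealSub A L X)
      map := fun {X Y} f => ModuleCat.ofHom
        (Submodule.mapQ _ _ (Linear.rightComp A (bigObj R N a) f) (fun h hh r => by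
          change ((h ≫ f) ≫ r).hom.hom ∈ L
          rw [Category.assoc]
          exact hh _))
      map_id := fun X => by
        ext h
        change Submodule.Quotient.mk (h ≫ 𝟙 X) = Submodule.Quotient.mk h
        rw [Category.comp_id]
      map_comp := fun f g => by
        ext h
        change Submodule.Quotient.mk (h ≫ f ≫ g) = Submodule.Quotient.mk ((h ≫ f) ≫ g)
        rw [Category.assoc] }
  property := by
    refine ⟨⟨fun {X Y f g} => ?_⟩, ⟨fun {X Y} f c => ?_⟩⟩
    · ext h
      exact congrArg (idealSub A L Y).mkQ (Preadditive.comp_add _ _ _ h f g)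
    · ext h
      exact congrArg (idealSub A L Y).mkQ (Linear.comp_smul _ _ _ h c f)

/-- The projection from `Hom(M, -)` to its quotient by a left ideal. -/
def toQuotientFunctor : homFunctor A R N a ⟶ quotientFunctor A L :=
  ObjectProperty.homMk
    { app := fun X => ModuleCat.ofHom (idealSub A L X).mkQ
      naturality := fun _ _ _ => rfl }

/-- A functor isomorphic to its quotient would give a surjection of the finite group `End(M)` onto
itself with kernel `L`. -/
lemma isProperSubquotient_quotientFunctor [Finite ι] [∀ i, Finite (N i)] (hL : L ≠ ⊥) :
    IsProperSubquotient (quotientFunctor A L) (homFunctor A R N a) := by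
  refine ⟨⟨homFunctor A R N a, 𝟙 _, toQuotientFunctor A L, fun X => Function.injective_id,
    fun X => (idealSub A L X).mkQ_surjective⟩, ?_⟩
  rintro ⟨α⟩
  have : Finite (bigObj R N a ⟶ bigObj R N a) :=
    Finite.of_injective (β := BigModule N a → BigModule N a)
      (fun h => (h.hom.hom : Module.End R (BigModule N a))) fun h h' hh => by
        ext1; ext1; exact DFunLike.coe_injective hh
  let β : ((bigObj R N a ⟶ bigObj R N a) ⧸ idealSub A L (bigObj R N a)) →
      (bigObj R N a ⟶ bigObj R N a) := α.hom.hom.app (bigObj R N a)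
  have hβ : Function.Surjective β := fun y =>
    ⟨α.inv.hom.app (bigObj R N a) y, congr($(congr(($(α.inv_hom_id)).hom.app (bigObj R N a))) y)⟩
  have hmk : Function.Injective (β ∘ Submodule.Quotient.mk) :=
    Finite.injective_iff_surjective.2 (hβ.comp (Submodule.Quotient.mk_surjective _))
  obtain ⟨l, hl, hne⟩ := Submodule.exists_mem_ne_zero_of_ne_bot hL
  have hl0 : bigHom R N a l = bigHom R N a 0 := by
    apply hmk.of_comp
    rw [Submodule.Quotient.eq]
    exact (mem_idealSub_bigHom A L (l - 0)).2 (by rwa [sub_zero])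
  exact hne congr(($hl0).hom.hom)

variable {A L} {K : Type*} [Field K] {V : Type*} [AddCommGroup V] [Module K V]
  {ρ : Representation K (BigModule N a ≃ₗ[R] BigModule N a) V}

lemma equivariant_eq_zero {F : FunCat A R N} (hF : ∀ T : (permRep K a F).IntertwiningMap ρ, T = 0)
    {t : F.obj.obj (bigObj R N a) → V}
    (ht : ∀ (g : BigModule N a ≃ₗ[R] BigModule N a) q,
      t (evalMap a F (g : BigModule N a →ₗ[R] BigModule N a) q) = ρ g (t q)) : t = 0 := by
  let T : (permRep K a F).IntertwiningMap ρ := ⟨Finsupp.linearCombination K t, fun g => by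
    refine Finsupp.lhom_ext' fun q => LinearMap.ext_ring ?_
    change Finsupp.linearCombination K t (Finsupp.mapDomain (evalMap a F _) (.single q 1)) =
      ρ g (Finsupp.linearCombination K t (.single q 1))
    rw [Finsupp.mapDomain_single, Finsupp.linearCombination_single,
      Finsupp.linearCombination_single, one_smul, one_smul, ht]⟩
  funext q
  have hq : Finsupp.linearCombination K t (.single q 1) = 0 := DFunLike.congr_fun (hF T) _
  rwa [Finsupp.linearCombination_single, one_smul] at hq

variable (A) in
lemma isPrimitiveRep_of_forall_properSubquotient [Finite ι] [∀ i, Finite (N i)]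
    (hρ : ∀ F : FunCat A R N, IsProperSubquotient F (homFunctor A R N a) →
      ∀ T : (permRep K a F).IntertwiningMap ρ, T = 0) :
    IsPrimitiveRep (ρ.comp
      (LinearMap.GeneralLinearGroup.generalLinearEquiv R (BigModule N a)).toMonoidHom) := by
  intro L hL t ht hinv
  let t' : (quotientFunctor A L).obj.obj (bigObj R N a) → V :=
    Quotient.lift (s := (idealSub A L (bigObj R N a)).quotientRel)
      (fun h => t (h.hom.hom : Module.End R (BigModule N a))) fun h h' hh => by
        have hmem : h - h' ∈ idealSub A L (bigObj R N a) := (Submodule.quotientRel_def _).1 hh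
        exact (congrArg t (add_sub_cancel (h'.hom.hom : Module.End R (BigModule N a)) _)).symm.trans
          (hinv _ _ (hmem (𝟙 _)))
  have ht' : t' = 0 := by
    refine equivariant_eq_zero (hρ _ (isProperSubquotient_quotientFunctor A L hL)) fun g q => ?_
    obtain ⟨h, rfl⟩ := Submodule.Quotient.mk_surjective _ q
    have hg := ht ((LinearMap.GeneralLinearGroup.generalLinearEquiv R (BigModule N a)).symm g)
      h.hom.hom
    rwa [MonoidHom.comp_apply, MulEquiv.toMonoidHom_eq_coe, MonoidHom.coe_coe,
      MulEquiv.apply_symm_apply] at hg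
  funext e
  exact congrFun ht' (Submodule.Quotient.mk (bigHom R N a e))

end QuotientFunctor

/-! ### Morphisms between finite indecomposable modules -/

section Indecomposable

variable {R : Type u} [Ring R] {X Y Z : Type v} [AddCommGroup X] [Module R X] [AddCommGroup Y]
  [Module R Y] [AddCommGroup Z] [Module R Z]

lemma IsIndecomposable.bijective_or_isNilpotent [Finite X] (hX : IsIndecomposable R X)
    (f : Module.End R X) : Function.Bijective f ∨ IsNilpotent f := by
  obtain ⟨n, hn⟩ := Filter.eventually_atTop.1 f.eventually_isCompl_ker_pow_range_pow
  have hc := hn (n + 1) n.le_succ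
  rcases hX.2 _ _ hc with h | h
  · left
    have hinj : Function.Injective (f ^ n * f : Module.End R X) := by
      rw [← pow_succ]; exact LinearMap.ker_eq_bot.1 h
    exact Finite.injective_iff_bijective.1 (Function.Injective.of_comp hinj)
  · right
    exact ⟨n + 1, LinearMap.range_eq_bot.1 h⟩

lemma IsIndecomposable.bijective_one_sub [Finite X] (hX : IsIndecomposable R X)
    {f : Module.End R X} (hf : ¬ Function.Bijective f) :
    Function.Bijective (1 - f : Module.End R X) :=
  (Module.End.isUnit_iff _).1 ((hX.bijective_or_isNilpotent f).resolve_left hf).isUnit_one_sub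

lemma isCompl_range_ker_of_bijective_comp {g : X →ₗ[R] Y} {h : Y →ₗ[R] Z}
    (hb : Function.Bijective (h ∘ₗ g)) : IsCompl (LinearMap.range g) (LinearMap.ker h) := by
  constructor
  · rw [Submodule.disjoint_def]
    rintro _ ⟨x, rfl⟩ hx
    rw [hb.1 (a₁ := x) (a₂ := 0) (by simpa using hx), map_zero]
  · rw [codisjoint_iff, eq_top_iff]
    intro y _
    obtain ⟨x, hx⟩ := hb.2 (h y)
    rw [← add_sub_cancel (g x) y]
    refine Submodule.add_mem_sup ⟨x, rfl⟩ ?_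
    rw [LinearMap.mem_ker, map_sub, sub_eq_zero]
    exact hx.symm

lemma bijective_of_bijective_comp [Nontrivial X] (hY : IsIndecomposable R Y) {g : X →ₗ[R] Y}
    {h : Y →ₗ[R] Z} (hb : Function.Bijective (h ∘ₗ g)) :
    Function.Bijective g ∧ Function.Bijective h := by
  have hg : Function.Injective g := Function.Injective.of_comp hb.1
  have hh : Function.Surjective h := Function.Surjective.of_comp hb.2
  have hc := isCompl_range_ker_of_bijective_comp hb
  have hrange : LinearMap.range g ≠ ⊥ := by
    intro h0
    rw [LinearMap.range_eq_bot] at h0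
    obtain ⟨x, y, hxy⟩ := exists_pair_ne X
    exact hxy (hg (by rw [h0]; rfl))
  have hker : LinearMap.ker h = ⊥ := (hY.2 _ _ hc).resolve_left hrange
  have htop : LinearMap.range g = ⊤ := by
    have := hc.sup_eq_top
    rwa [hker, sup_bot_eq] at this
  exact ⟨⟨hg, LinearMap.range_eq_top.1 htop⟩, LinearMap.ker_eq_bot.1 hker, hh⟩

lemma not_bijective_zero [Nontrivial X] : ¬ Function.Bijective (0 : X →ₗ[R] Y) := by
  intro h
  obtain ⟨x, y, hxy⟩ := exists_pair_ne X
  exact hxy (h.1 rfl)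

lemma not_bijective_add [Finite X] (hX : IsIndecomposable R X) {f g : X →ₗ[R] Y}
    (hf : ¬ Function.Bijective f) (hg : ¬ Function.Bijective g) :
    ¬ Function.Bijective (f + g) := by
  intro hb
  let e := LinearEquiv.ofBijective (f + g) hb
  have hcancel : ∀ k : X →ₗ[R] Y,
      Function.Bijective (e.symm.toLinearMap ∘ₗ k) → Function.Bijective k := by
    intro k hk
    rw [LinearMap.coe_comp] at hk
    exact (Function.Bijective.of_comp_iff' e.symm.bijective _).1 hk
  have hsum : (e.symm.toLinearMap ∘ₗ g : Module.End R X) = 1 - e.symm.toLinearMap ∘ₗ f := by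
    ext x
    change e.symm (g x) = x - e.symm (f x)
    rw [eq_sub_iff_add_eq, ← map_add, add_comm]
    exact e.symm_apply_apply x
  apply hg
  apply hcancel
  rw [hsum]
  exact hX.bijective_one_sub fun h => hf (hcancel f h)

lemma mem_jacobson_end_iff [Finite X] (hX : IsIndecomposable R X) {f : Module.End R X} :
    f ∈ Ring.jacobson (Module.End R X) ↔ ¬ Function.Bijective f := by
  have := hX.1
  constructor
  · intro hu hb
    exact (Ring.jacobson_lt_top (Module.End R X)).ne
      (Ideal.eq_top_of_isUnit_mem _ hu ((Module.End.isUnit_iff f).2 hb))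
  · -- otherwise `1` is a sum of a multiple of `f` and an element of a maximal left ideal
    intro hf
    rw [Ring.jacobson_eq_sInf_isMaximal, Submodule.mem_sInf]
    intro m hm
    have hm : Ideal.IsMaximal m := hm
    by_contra hfm
    obtain ⟨r, y, hy, h1⟩ := hm.exists_inv hfm
    refine not_bijective_add hX (f := r * f) (g := y) ?_ ?_ ?_
    · exact fun h => hf (bijective_of_bijective_comp hX h).1
    · exact fun h =>
        hm.ne_top (Ideal.eq_top_of_isUnit_mem _ hy ((Module.End.isUnit_iff y).2 h))
    · rw [h1]; exact Function.bijective_id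

/-- The division ring structure on the residue ring of a finite indecomposable module; it is not an
instance because it depends on indecomposability. -/
@[reducible] def residueDivisionRing [Finite X] (hX : IsIndecomposable R X) :
    DivisionRing (Module.End R X ⧸ Ring.jacobson (Module.End R X)) :=
  haveI := hX.1
  haveI : Nontrivial (Module.End R X ⧸ Ring.jacobson (Module.End R X)) :=
    Ideal.Quotient.nontrivial_iff.2 (Ring.jacobson_lt_top _).ne
  DivisionRing.ofIsUnitOrEqZero fun x => by
    obtain ⟨f, rfl⟩ := Ideal.Quotient.mk_surjective x
    by_cases hf : Function.Bijective f
    · exact Or.inl (((Module.End.isUnit_iff f).2 hf).map _)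
    · exact Or.inr (Ideal.Quotient.eq_zero_iff_mem.2 ((mem_jacobson_end_iff hX).2 hf))

instance finite_linearMap [Finite X] [Finite Y] : Finite (X →ₗ[R] Y) :=
  DFunLike.finite _

lemma not_bijective_commutator [Finite X] (hX : IsIndecomposable R X) (f g : Module.End R X) :
    ¬ Function.Bijective (f * g - g * f) := by
  let := residueDivisionRing hX
  rw [← mem_jacobson_end_iff hX, ← Ideal.Quotient.eq_zero_iff_mem, map_sub, map_mul, map_mul,
    sub_eq_zero]
  have : Finite (Module.End R X ⧸ Ring.jacobson (Module.End R X)) :=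
    Finite.of_surjective _ Ideal.Quotient.mk_surjective
  let := littleWedderburn (Module.End R X ⧸ Ring.jacobson (Module.End R X))
  exact mul_comm (Ideal.Quotient.mk (Ring.jacobson (Module.End R X)) f) _

open scoped Classical in
/-- Gaussian elimination: `1 - c x x` is invertible, and eliminating the variable `m x` changes the
other coefficients only by non-bijective maps. -/
lemma eq_zero_of_eq_sum_of_not_bijective {κ : Type*} {X : κ → Type v} [∀ y, AddCommGroup (X y)]
    [∀ y, Module R (X y)] [∀ y, Finite (X y)] (hX : ∀ y, IsIndecomposable R (X y))
    {c : ∀ y z, X z →ₗ[R] X y} (hc : ∀ y z, ¬ Function.Bijective (c y z)) {m : ∀ y, X y}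
    {S : Finset κ} (hm : ∀ y ∈ S, m y = ∑ z ∈ S, c y z (m z)) : ∀ y ∈ S, m y = 0 := by
  have hnt := fun y => (hX y).1
  induction S using Finset.induction_on generalizing c with
  | empty => simp
  | insert x S hx ih =>
    let e : X x ≃ₗ[R] X x :=
      LinearEquiv.ofBijective _ ((hX x).bijective_one_sub (f := c x x) (hc x x))
    have hmx : m x = e.symm (∑ z ∈ S, c x z (m z)) := by
      rw [LinearEquiv.eq_symm_apply]
      have := hm x (Finset.mem_insert_self _ _)
      rw [Finset.sum_insert hx] at this
      change m x - c x x (m x) = _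
      rwa [sub_eq_iff_eq_add']
    have hS : ∀ y ∈ S, m y = 0 := by
      refine ih (c := fun y z => c y z + c y x ∘ₗ e.symm.toLinearMap ∘ₗ c x z) ?_ ?_
      · intro y z
        refine not_bijective_add (hX z) (hc y z) fun h => ?_
        exact hc y x (bijective_of_bijective_comp (hX x) h).2
      · intro y hy
        rw [hm y (Finset.mem_insert_of_mem hy), Finset.sum_insert hx]
        simp only [LinearMap.add_apply, Finset.sum_add_distrib, LinearMap.comp_apply]
        rw [← map_sum, LinearEquiv.coe_coe, ← map_sum, ← hmx, add_comm]
    intro y hy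
    rcases Finset.mem_insert.1 hy with rfl | hy
    · rw [hmx, Finset.sum_eq_zero fun z hz => by rw [hS z hz, map_zero], map_zero]
    · exact hS y hy

end Indecomposable

/-! ### Entries of endomorphisms of `⨁ᵢ Nᵢ ^ aᵢ` -/

section Entries

variable {R : Type u} [Ring R] {ι : Type} {N : ι → Type v}
  [∀ i, AddCommGroup (N i)] [∀ i, Module R (N i)] {a : ι → ℕ}

/-- The positions of the indecomposable summands of `⨁ᵢ Nᵢ ^ aᵢ`. -/
abbrev Slot (a : ι → ℕ) : Type := (i : ι) × Fin (a i)

variable (R N) in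
/-- The projection of `⨁ᵢ Nᵢ ^ aᵢ` to a summand. -/
def prj (y : Slot a) : BigModule N a →ₗ[R] N y.1 :=
  LinearMap.proj (R := R) (φ := fun _ : Fin (a y.1) => N y.1) y.2 ∘ₗ
    LinearMap.proj (R := R) (φ := fun i => Fin (a i) → N i) y.1

lemma ext_prj {m m' : BigModule N a} (h : ∀ y, prj R N y m = prj R N y m') : m = m' := by
  funext i s
  exact h ⟨i, s⟩

@[simp] lemma prj_apply (y : Slot a) (m : BigModule N a) : prj R N y m = m y.1 y.2 := rfl

variable [DecidableEq ι]

variable (R N) in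
/-- The inclusion of a summand in `⨁ᵢ Nᵢ ^ aᵢ`. -/
def inc (y : Slot a) : N y.1 →ₗ[R] BigModule N a :=
  LinearMap.single R (fun i => Fin (a i) → N i) y.1 ∘ₗ LinearMap.single R (fun _ => N y.1) y.2

lemma prj_inc_self (y : Slot a) : prj R N y ∘ₗ inc R N y = LinearMap.id := by
  ext m
  simp [inc]

lemma prj_inc_of_ne {y z : Slot a} (h : y ≠ z) : prj R N y ∘ₗ inc R N z = 0 := by
  ext m
  obtain ⟨i, s⟩ := y
  obtain ⟨j, t⟩ := z
  by_cases hij : i = j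
  · subst hij
    have hst : s ≠ t := fun hst => h (by rw [hst])
    simp [inc, Pi.single_eq_of_ne hst]
  · simp [inc, Pi.single_eq_of_ne hij]

lemma prj_inc_apply_self (y : Slot a) (m : N y.1) : prj R N y (inc R N y m) = m :=
  LinearMap.congr_fun (prj_inc_self y) m

lemma prj_inc_apply_of_ne {y z : Slot a} (h : y ≠ z) (m : N z.1) : prj R N y (inc R N z m) = 0 :=
  LinearMap.congr_fun (prj_inc_of_ne h) m

lemma inc_injective (y : Slot a) : Function.Injective (inc R N y) :=
  Function.LeftInverse.injective (prj_inc_apply_self y)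

lemma inc_comp_ne_zero {X : Type*} [AddCommGroup X] [Module R X] (y : Slot a) {f : X →ₗ[R] N y.1}
    (hf : f ≠ 0) : inc R N y ∘ₗ f ≠ 0 := by
  intro h
  apply hf
  ext m
  exact inc_injective (R := R) y ((LinearMap.congr_fun h m).trans (map_zero _).symm)

lemma sum_inc_prj_apply [Fintype ι] (m : BigModule N a) :
    ∑ y : Slot a, inc R N y (prj R N y m) = m := by
  refine ext_prj (R := R) fun z => ?_
  rw [map_sum, Finset.sum_eq_single z, prj_inc_apply_self]
  · intro y _ hy
    exact prj_inc_apply_of_ne hy.symm _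
  · simp

variable [Finite ι]

lemma linearMap_ext_inc {X : Type*} [AddCommGroup X] [Module R X] {f g : BigModule N a →ₗ[R] X}
    (h : ∀ y, f ∘ₗ inc R N y = g ∘ₗ inc R N y) : f = g := by
  have := Fintype.ofFinite ι
  refine LinearMap.ext fun m => ?_
  rw [← sum_inc_prj_apply (R := R) m, map_sum, map_sum]
  exact Finset.sum_congr rfl fun y _ => LinearMap.congr_fun (h y) _

lemma bijective_one_sub_of_entries [∀ i, Finite (N i)] (hN : ∀ i, IsIndecomposable R (N i))
    (u : Module.End R (BigModule N a))
    (hu : ∀ y z, ¬ Function.Bijective (prj R N y ∘ₗ u ∘ₗ inc R N z)) :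
    Function.Bijective (1 - u : Module.End R (BigModule N a)) := by
  have := Fintype.ofFinite ι
  refine Finite.injective_iff_bijective.1 ((injective_iff_map_eq_zero _).2 fun m hm => ?_)
  have hm' : m = u m := sub_eq_zero.1 hm
  refine ext_prj (R := R) fun y => ?_
  rw [map_zero]
  refine eq_zero_of_eq_sum_of_not_bijective (fun y : Slot a => hN y.1) hu
    (m := fun y => prj R N y m) (S := Finset.univ) (fun y _ => ?_) y (Finset.mem_univ y)
  conv_lhs => rw [hm', ← sum_inc_prj_apply (R := R) m, map_sum, map_sum]
  rfl

end Entries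

/-! ### Morphisms killed by all non-bijective morphisms -/

section Socle

variable {R : Type u} [Ring R] {ι : Type} {N : ι → Type v}
  [∀ i, AddCommGroup (N i)] [∀ i, Module R (N i)]

lemma not_bijective_comp_left {i k l : ι} (hN : ∀ i, IsIndecomposable R (N i))
    {g : N k →ₗ[R] N l} (hg : ¬ Function.Bijective g) (f : N i →ₗ[R] N k) :
    ¬ Function.Bijective (g ∘ₗ f) := fun h =>
  haveI := (hN i).1
  hg (bijective_of_bijective_comp (hN k) h).2

lemma not_bijective_comp_right {i k l : ι} (hN : ∀ i, IsIndecomposable R (N i))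
    (g : N k →ₗ[R] N l) {f : N i →ₗ[R] N k} (hf : ¬ Function.Bijective f) :
    ¬ Function.Bijective (g ∘ₗ f) := fun h =>
  haveI := (hN i).1
  hf (bijective_of_bijective_comp (hN k) h).1

/-- The morphisms `X → Nᵢ` that are killed by every non-bijective morphism out of `Nᵢ`. For
`X = N_j` the non-bijective ones among them make up `LM(N_j, Nᵢ)`. -/
def socle (hN : ∀ i, IsIndecomposable R (N i)) (X : Type v) [AddCommGroup X] [Module R X] (i : ι) :
    Submodule (Module.End R (N i)) (X →ₗ[R] N i) where
  carrier := {f | ∀ (k : ι) (g : N i →ₗ[R] N k), ¬ Function.Bijective g → g ∘ₗ f = 0}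
  zero_mem' k g _ := LinearMap.comp_zero g
  add_mem' hf hf' k g hg := by rw [LinearMap.comp_add, hf k g hg, hf' k g hg, add_zero]
  smul_mem' e f hf k g hg :=
    hf k (g ∘ₗ e) (not_bijective_comp_left hN hg e)

variable [∀ i, Finite (N i)] {hN : ∀ i, IsIndecomposable R (N i)} {X : Type v} [AddCommGroup X]
  [Module R X]

lemma isTorsion_socle (i : ι) : Module.IsTorsionBySet (Module.End R (N i))
    (socle hN X i) (Ring.jacobson (Module.End R (N i)) : Ideal (Module.End R (N i))) := by
  rintro ⟨f, hf⟩ ⟨u, hu⟩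
  exact Subtype.ext (hf i u ((mem_jacobson_end_iff (hN i)).1 hu))

instance moduleSocle (i : ι) : Module (Residue R N i) (socle hN X i) :=
  (isTorsion_socle i).module

lemma mem_LM_iff (hN : ∀ i, IsIndecomposable R (N i)) {j i : ι}
    {f : N j →ₗ[R] N i} : f ∈ LM R N j i ↔ ¬ Function.Bijective f ∧ f ∈ socle hN (N j) i := by
  have := (hN j).1
  constructor
  · intro hf
    unfold LM at hf
    induction hf using Submodule.span_induction with
    | mem f hf => exact hf.2
    | zero => exact ⟨not_bijective_zero, zero_mem _⟩
    | add f g _ _ h1 h2 => exact ⟨not_bijective_add (hN j) h1.1 h2.1, add_mem h1.2 h2.2⟩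
    | smul e f _ h => exact ⟨not_bijective_comp_right hN e h.1, (socle hN (N j) i).smul_mem e h.2⟩
  · rintro ⟨h1, h2⟩
    by_cases h0 : f = 0
    · rw [h0]; exact zero_mem _
    · exact Submodule.subset_span ⟨h0, h1, h2⟩

lemma isLeftMaximal_of_mem_LM (hN : ∀ i, IsIndecomposable R (N i)) {j i : ι}
    {f : N j →ₗ[R] N i} (hf : f ∈ LM R N j i) (h0 : f ≠ 0) : IsLeftMaximal N f :=
  ⟨h0, (mem_LM_iff hN).1 hf⟩

instance finite_residue (i : ι) : Finite (Residue R N i) :=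
  Finite.of_surjective _ Ideal.Quotient.mk_surjective

lemma one_lt_card_residue (hN : ∀ i, IsIndecomposable R (N i)) (i : ι) :
    1 < Nat.card (Residue R N i) := by
  let := residueDivisionRing (hN i)
  exact Finite.one_lt_card

lemma card_LM (hN : ∀ i, IsIndecomposable R (N i)) (j i : ι) :
    Nat.card (LM R N j i) = Nat.card (Residue R N i) ^ numArrows R N j i := by
  let := residueDivisionRing (hN i)
  exact Module.natCard_eq_pow_finrank (K := Residue R N i) (V := LM R N j i)

lemma numArrows_ne_zero_iff (hN : ∀ i, IsIndecomposable R (N i)) {j i : ι} :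
    numArrows R N j i ≠ 0 ↔ ∃ f ∈ LM R N j i, f ≠ 0 := by
  let := residueDivisionRing (hN i)
  rw [← Nat.pos_iff_ne_zero, numArrows, Module.finrank_pos_iff_exists_ne_zero]
  simp only [Subtype.exists, ne_eq, Submodule.mk_eq_zero, exists_prop]

/-- The dimension over `Eᵢ` of the space of morphisms `N_j → Nᵢ` killed by all non-bijective
morphisms out of `Nᵢ`. -/
def socleRank (hN : ∀ i, IsIndecomposable R (N i)) (j i : ι) : ℕ :=
  Module.finrank (Residue R N i) (socle hN (N j) i)

lemma card_socle (hN : ∀ i, IsIndecomposable R (N i)) (j i : ι) :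
    Nat.card (socle hN (N j) i) = Nat.card (Residue R N i) ^ socleRank hN j i := by
  let := residueDivisionRing (hN i)
  exact Module.natCard_eq_pow_finrank (K := Residue R N i) (V := socle hN (N j) i)

lemma numArrows_le_socleRank (hN : ∀ i, IsIndecomposable R (N i)) (j i : ι) :
    numArrows R N j i ≤ socleRank hN j i := by
  rw [← Nat.pow_le_pow_iff_right (one_lt_card_residue hN i), ← card_LM hN, ← card_socle]
  exact Nat.card_le_card_of_injective (fun f => ⟨f.1, ((mem_LM_iff hN).1 f.2).2⟩)
    fun f g h => Subtype.ext (congrArg (fun u : socle hN (N j) i => u.1) h)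

lemma socleRank_ne_zero (hN : ∀ i, IsIndecomposable R (N i)) {j i : ι} {f : N j →ₗ[R] N i}
    (hf : f ∈ socle hN (N j) i) (h0 : f ≠ 0) : socleRank hN j i ≠ 0 := by
  let := residueDivisionRing (hN i)
  rw [← Nat.pos_iff_ne_zero, socleRank, Module.finrank_pos_iff_exists_ne_zero]
  exact ⟨⟨f, hf⟩, fun h => h0 (congrArg Subtype.val h)⟩

end Socle

/-! ### The rank bound from a generating character of `End(M)` -/

section RankBound

variable {R : Type u} [Ring R] {ι : Type} {N : ι → Type v} [∀ i, AddCommGroup (N i)]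
  [∀ i, Module R (N i)] {a : ι → ℕ} {hN : ∀ i, IsIndecomposable R (N i)}

lemma comp_socle_eq_sum [Finite ι] [DecidableEq ι]
    (hne : ∀ i j, i ≠ j → IsEmpty (N i ≃ₗ[R] N j)) {X : Type v} [AddCommGroup X] [Module R X]
    {i : ι} {f : X →ₗ[R] N i} (hf : f ∈ socle hN X i) (φ : N i →ₗ[R] BigModule N a) :
    φ ∘ₗ f = ∑ s : Fin (a i), inc R N ⟨i, s⟩ ∘ₗ (prj R N ⟨i, s⟩ ∘ₗ φ) ∘ₗ f := by
  have := Fintype.ofFinite ι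
  have hsum : φ ∘ₗ f = ∑ y : Slot a, inc R N y ∘ₗ (prj R N y ∘ₗ φ) ∘ₗ f := by
    ext1 x
    rw [LinearMap.sum_apply]
    exact (sum_inc_prj_apply (R := R) (φ (f x))).symm
  rw [hsum, Fintype.sum_sigma, Finset.sum_eq_single i]
  · intro j _ hji
    refine Finset.sum_eq_zero fun s _ => ?_
    rw [hf j _ fun hb => (hne i j hji.symm).false (LinearEquiv.ofBijective _ hb),
      LinearMap.comp_zero]
  · simp

variable [∀ i, Finite (N i)]

/-- The map `Hom(M, Nᵢ) × Hom(Nᵢ, M) → End(M)` given by composition, restricted to the morphisms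
`f : M → Nᵢ` killed by all non-bijective morphisms: then only the entries `Nᵢ → Nᵢ` modulo the
radical of the second factor matter. -/
def socleComp [DecidableEq ι] (i : ι) : socle hN (BigModule N a) i →+
    (Fin (a i) → Residue R N i) →+ Module.End R (BigModule N a) :=
  AddMonoidHom.mk' (fun f => AddMonoidHom.mk' (fun e => ∑ s, inc R N ⟨i, s⟩ ∘ₗ (e s • f).1)
    fun e e' => by
      rw [← Finset.sum_add_distrib]
      refine Finset.sum_congr rfl fun s _ => ?_
      rw [Pi.add_apply, add_smul, Submodule.coe_add, LinearMap.comp_add])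
    fun f f' => by
      refine AddMonoidHom.ext fun e => ?_
      change (∑ s, inc R N ⟨i, s⟩ ∘ₗ (e s • (f + f')).1 : Module.End R (BigModule N a)) =
        ∑ s, inc R N ⟨i, s⟩ ∘ₗ (e s • f).1 + ∑ s, inc R N ⟨i, s⟩ ∘ₗ (e s • f').1
      rw [← Finset.sum_add_distrib]
      refine Finset.sum_congr rfl fun s _ => ?_
      rw [smul_add, Submodule.coe_add, LinearMap.comp_add]

variable {K : Type*} [Field K] {χ : AddChar (Module.End R (BigModule N a)) K}

lemma eq_zero_of_forall_socleComp_eq_one [Finite ι] [DecidableEq ι]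
    (hχ : IsGeneratingChar (Module.End R (BigModule N a)) χ)
    (hne : ∀ i j, i ≠ j → IsEmpty (N i ≃ₗ[R] N j)) {i : ι} (hi : 0 < a i)
    {f : socle hN (BigModule N a) i} (hf : ∀ e, χ (socleComp i f e) = 1) : f = 0 := by
  have hinc : inc R N ⟨i, ⟨0, hi⟩⟩ ∘ₗ f.1 = 0 := by
    refine hχ _ fun s => ?_
    rw [smul_eq_mul, Module.End.mul_eq_comp, ← LinearMap.comp_assoc, comp_socle_eq_sum hne f.2]
    exact hf fun t => Ideal.Quotient.mk _ (prj R N ⟨i, t⟩ ∘ₗ s ∘ₗ inc R N ⟨i, ⟨0, hi⟩⟩)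
  by_contra h0
  exact inc_comp_ne_zero ⟨i, ⟨0, hi⟩⟩ (fun h => h0 (Subtype.ext h)) hinc

variable [IsAlgClosed K] [CharZero K]

lemma card_socle_le [Finite ι] (hχ : IsGeneratingChar (Module.End R (BigModule N a)) χ)
    (hne : ∀ i j, i ≠ j → IsEmpty (N i ≃ₗ[R] N j)) {i : ι} (hi : 0 < a i) :
    Nat.card (socle hN (BigModule N a) i) ≤ Nat.card (Residue R N i) ^ a i := by
  classical
  let β (f : socle hN (BigModule N a) i) : AddChar (Fin (a i) → Residue R N i) K :=
    χ.compAddMonoidHom (socleComp i f : (Fin (a i) → Residue R N i) →+ _)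
  have hβ : Function.Injective β := by
    refine fun f f' h => sub_eq_zero.1 (eq_zero_of_forall_socleComp_eq_one hχ hne hi fun e => ?_)
    have he : χ (socleComp i f e) = χ (socleComp i f' e) := DFunLike.congr_fun h e
    rw [map_sub, AddMonoidHom.sub_apply, AddChar.map_sub_eq_div, he,
      div_self (χ.val_isUnit _).ne_zero]
  have hcard := Nat.card_le_card_of_injective β hβ
  rwa [natCard_addChar, Nat.card_fun, Nat.card_fin] at hcard

lemma sum_socleRank_mul_le [Fintype ι] (hχ : IsGeneratingChar (Module.End R (BigModule N a)) χ)
    (hne : ∀ i j, i ≠ j → IsEmpty (N i ≃ₗ[R] N j)) {i : ι} (hi : 0 < a i) :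
    ∑ j, socleRank hN j i * a j ≤ a i := by
  classical
  let Φ (h : ∀ y : Slot a, socle hN (N y.1) i) : socle hN (BigModule N a) i :=
    ⟨∑ y, (h y).1 ∘ₗ prj R N y, Submodule.sum_mem _ fun y _ k g hg => by
      rw [← LinearMap.comp_assoc, (h y).2 k g hg, LinearMap.zero_comp]⟩
  have hΦ_inc (h : ∀ y : Slot a, socle hN (N y.1) i) (z : Slot a) :
      (Φ h).1 ∘ₗ inc R N z = (h z).1 := by
    change (∑ y, (h y).1 ∘ₗ prj R N y) ∘ₗ inc R N z = (h z).1
    ext1 m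
    rw [LinearMap.comp_apply, LinearMap.sum_apply, Finset.sum_eq_single z]
    · rw [LinearMap.comp_apply, prj_inc_apply_self]
    · intro y _ hy
      rw [LinearMap.comp_apply, prj_inc_apply_of_ne hy, map_zero]
    · simp
  have hΦ : Function.Injective Φ := fun h h' hh => funext fun z =>
    Subtype.ext (by rw [← hΦ_inc h, ← hΦ_inc h', hh])
  have hcard := (Nat.card_le_card_of_injective Φ hΦ).trans (card_socle_le hχ hne hi)
  rw [Nat.card_pi, Fintype.prod_sigma] at hcard
  simp_rw [card_socle hN, Finset.prod_const, Finset.card_univ, Fintype.card_fin, ← pow_mul] at hcard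
  rw [Finset.prod_pow_eq_pow_sum] at hcard
  exact (Nat.pow_le_pow_iff_right (one_lt_card_residue hN i)).1 hcard

lemma sum_numArrows_mul_le [Fintype ι] (hχ : IsGeneratingChar (Module.End R (BigModule N a)) χ)
    (hN : ∀ i, IsIndecomposable R (N i)) (hne : ∀ i j, i ≠ j → IsEmpty (N i ≃ₗ[R] N j)) {i : ι}
    (hi : 0 < a i) : ∑ j, numArrows R N j i * a j ≤ a i :=
  (Finset.sum_le_sum fun j _ => Nat.mul_le_mul_right _ (numArrows_le_socleRank hN j i)).trans
    (sum_socleRank_mul_le hχ hne hi)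

/-- The identity of `Nᵢ` contributes `aᵢ` to the sum bounded by `sum_socleRank_mul_le`, which leaves
no room for other morphisms. -/
lemma eq_zero_of_hom_out_eq_zero [Finite ι]
    (hχ : IsGeneratingChar (Module.End R (BigModule N a)) χ)
    (hN : ∀ i, IsIndecomposable R (N i)) (hne : ∀ i j, i ≠ j → IsEmpty (N i ≃ₗ[R] N j))
    (ha : ∀ i, 0 < a i) {i j : ι} (hji : j ≠ i)
    (hout : ∀ k (g : N i →ₗ[R] N k), ¬ Function.Bijective g → g = 0) (f : N j →ₗ[R] N i) :
    f = 0 := by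
  have := Fintype.ofFinite ι
  have := (hN i).1
  have hall {k : ι} (f : N k →ₗ[R] N i) : f ∈ socle hN (N k) i := fun l g hg => by
    rw [hout l g hg, LinearMap.zero_comp]
  by_contra hf
  have hid := socleRank_ne_zero hN (hall (1 : Module.End R (N i))) one_ne_zero
  have hj := socleRank_ne_zero hN (hall f) hf
  have hsum : socleRank hN j i * a j + socleRank hN i i * a i ≤ a i :=
    (Finset.add_le_sum (f := fun k => socleRank hN k i * a k) (fun _ _ => Nat.zero_le _)
      (Finset.mem_univ j) (Finset.mem_univ i) hji).trans (sum_socleRank_mul_le hχ hne (ha i))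
  have := Nat.le_mul_of_pos_left (a i) (Nat.pos_of_ne_zero hid)
  have := Nat.mul_pos (Nat.pos_of_ne_zero hj) (ha j)
  omega

end RankBound

/-! ### The shape of the left maximal graph -/

section Shape

lemma eq_ite_of_sum_eq_one {ι : Type*} [Fintype ι] [DecidableEq ι] {d : ι → ℕ}
    (hd : ∑ i, d i = 1) {k : ι} (hk : d k ≠ 0) (i : ι) : d i = if i = k then 1 else 0 := by
  rw [← Finset.add_sum_erase _ _ (Finset.mem_univ k)] at hd
  split_ifs with hi
  · rw [hi]
    omega
  · have hrest : ∑ i ∈ Finset.univ.erase k, d i = 0 := by omega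
    exact Finset.sum_eq_zero_iff.1 hrest i (Finset.mem_erase.2 ⟨hi, Finset.mem_univ i⟩)

lemma exists_perm_of_sum_le {ι : Type*} [Fintype ι] [DecidableEq ι] (d : ι → ι → ℕ) (a : ι → ℕ)
    (ha : ∀ i, 0 < a i) (hin : ∀ i, ∑ j, d j i * a j ≤ a i) (hout : ∀ j, ∃ i, d j i ≠ 0) :
    ∃ s : Equiv.Perm ι, (∀ j i, d j i = if i = s j then 1 else 0) ∧ ∀ j, a (s j) = a j := by
  have hge : ∀ j, a j ≤ ∑ i, d j i * a j := by
    intro j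
    obtain ⟨i, hi⟩ := hout j
    calc a j ≤ d j i * a j := Nat.le_mul_of_pos_left _ (Nat.pos_of_ne_zero hi)
      _ ≤ _ := Finset.single_le_sum (f := fun i => d j i * a j) (fun _ _ => Nat.zero_le _)
        (Finset.mem_univ i)
  have hswap : ∑ i, ∑ j, d j i * a j = ∑ j, ∑ i, d j i * a j := Finset.sum_comm
  have hle1 : ∑ i, ∑ j, d j i * a j ≤ ∑ i, a i := Finset.sum_le_sum fun i _ => hin i
  have hle2 : ∑ j, a j ≤ ∑ j, ∑ i, d j i * a j := Finset.sum_le_sum fun j _ => hge j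
  have heq1 : ∀ i, ∑ j, d j i * a j = a i := fun i =>
    (Finset.sum_eq_sum_iff_of_le fun i _ => hin i).1 (by omega) i (Finset.mem_univ i)
  have heq2 : ∀ j, ∑ i, d j i = 1 := fun j => by
    have h := (Finset.sum_eq_sum_iff_of_le fun j _ => hge j).1 (by omega) j (Finset.mem_univ j)
    rw [← Finset.sum_mul] at h
    exact Nat.eq_of_mul_eq_mul_right (ha j) (by rw [one_mul]; exact h.symm)
  choose s hs using hout
  have hd : ∀ j i, d j i = if i = s j then 1 else 0 := fun j =>
    eq_ite_of_sum_eq_one (heq2 j) (hs j)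
  have hsurj : Function.Surjective s := by
    intro i
    by_contra! hcon
    have h := heq1 i
    rw [Finset.sum_eq_zero fun j _ => by rw [hd, if_neg (hcon j).symm, zero_mul]] at h
    exact (ha i).ne h
  have hbij : Function.Bijective s := Finite.surjective_iff_bijective.1 hsurj
  refine ⟨Equiv.ofBijective s hbij, hd, fun j => ?_⟩
  change a (s j) = a j
  rw [← heq1 (s j), Finset.sum_eq_single j]
  · rw [hd, if_pos rfl, one_mul]
  · intro j' _ hj'
    rw [hd, if_neg fun h => hj' (hbij.1 h).symm, zero_mul]
  · simp

variable {R : Type u} [Ring R] {ι : Type} {N : ι → Type v} [∀ i, AddCommGroup (N i)]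
  [∀ i, Module R (N i)]

/-- The morphisms from `N_j` to the `N_l` that factor through `f`. -/
def factorSet {j k : ι} (f : N j →ₗ[R] N k) : Set (Σ l, N j →ₗ[R] N l) :=
  {h | ∃ φ : N k →ₗ[R] N h.1, h.2 = φ ∘ₗ f}

lemma factorSet_comp_ssubset [∀ i, Finite (N i)] (hN : ∀ i, IsIndecomposable R (N i)) {j k l : ι}
    {f : N j →ₗ[R] N k} (hf : f ≠ 0) {g : N k →ₗ[R] N l} (hg : ¬ Function.Bijective g) :
    factorSet (g ∘ₗ f) ⊂ factorSet f := by
  refine ssubset_of_subset_of_ne (fun h ⟨φ, hφ⟩ => ⟨φ ∘ₗ g, hφ⟩) fun heq => hf ?_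
  have hmem : ⟨k, f⟩ ∈ factorSet (g ∘ₗ f) := heq ▸ ⟨LinearMap.id, rfl⟩
  obtain ⟨φ, hφ : f = φ ∘ₗ g ∘ₗ f⟩ := hmem
  have hunit := (hN k).bijective_one_sub (f := φ ∘ₗ g) (not_bijective_comp_right hN φ hg)
  ext1 x
  refine hunit.1 ((sub_eq_zero.2 ?_).trans (map_zero _).symm)
  exact LinearMap.congr_fun hφ x

lemma exists_numArrows_ne_zero [Finite ι] [∀ i, Finite (N i)] (hN : ∀ i, IsIndecomposable R (N i))
    {j k : ι} {f : N j →ₗ[R] N k} (hf0 : f ≠ 0) (hf : ¬ Function.Bijective f) :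
    ∃ i, numArrows R N j i ≠ 0 := by
  induction hn : (factorSet f).ncard using Nat.strong_induction_on generalizing k with
  | _ n ih =>
  by_cases hmax : f ∈ socle hN (N j) k
  · exact ⟨k, (numArrows_ne_zero_iff hN).2 ⟨f, (mem_LM_iff hN).2 ⟨hf, hmax⟩, hf0⟩⟩
  · obtain ⟨l, g, hg, hgf⟩ : ∃ (l : ι) (g : N k →ₗ[R] N l),
        ¬ Function.Bijective g ∧ g ∘ₗ f ≠ 0 := by
      by_contra! hcon
      exact hmax hcon
    exact ih _ (hn ▸ Set.ncard_lt_ncard (factorSet_comp_ssubset hN hf0 hg)) hgf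
      (not_bijective_comp_left hN hg f) rfl

lemma autSplits_of_forall_commute {X : Type v} [AddCommGroup X] [Module R X] {e : Module.End R X}
    (he : IsIdempotentElem e) (hcomm : ∀ g : Module.End R X, Commute g e) (h0 : e ≠ 0)
    (h1 : e ≠ 1) : AutSplits R X := by
  have hker (g : X ≃ₗ[R] X) : (LinearMap.ker e).map (g : X →ₗ[R] X) = LinearMap.ker e := by
    rw [Submodule.map_equiv_eq_comap_symm, ← LinearMap.ker_comp, ← Module.End.mul_eq_comp,
      ← (hcomm g.symm).eq]
    exact LinearEquiv.ker_comp _ _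
  have hrange (g : X ≃ₗ[R] X) : (LinearMap.range e).map (g : X →ₗ[R] X) = LinearMap.range e := by
    rw [← LinearMap.range_comp, ← Module.End.mul_eq_comp, (hcomm g).eq]
    exact LinearEquiv.range_comp _ _
  refine ⟨LinearMap.range e, LinearMap.ker e, LinearMap.IsIdempotentElem.isCompl he, ?_, ?_,
    fun g => ⟨g.ofSubmodules _ _ (hrange g), g.ofSubmodules _ _ (hker g), fun _ => rfl,
      fun _ => rfl⟩⟩
  · exact mt LinearMap.range_eq_bot.1 h0
  · refine fun hbot => h1 (LinearMap.ext fun x => LinearMap.ker_eq_bot.1 hbot ?_)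
    exact LinearMap.congr_fun he x

section BlockProj

variable [DecidableEq ι] {a : ι → ℕ}

variable (R N a) in
/-- The projection of `⨁ᵢ Nᵢ ^ aᵢ` to the summand `Nᵢ ^ aᵢ`, as an idempotent endomorphism. -/
def blockProj (i : ι) : Module.End R (BigModule N a) :=
  LinearMap.single R (fun i => Fin (a i) → N i) i ∘ₗ LinearMap.proj i

lemma blockProj_inc (i : ι) (z : Slot a) (x : N z.1) :
    blockProj R N a i (inc R N z x) = if z.1 = i then inc R N z x else 0 := by
  obtain ⟨k, s⟩ := z
  split_ifs with hk
  · subst hk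
    simp [blockProj, inc]
  · simp [blockProj, inc, Pi.single_eq_of_ne (Ne.symm hk)]

lemma prj_blockProj (i : ι) (y : Slot a) (m : BigModule N a) :
    prj R N y (blockProj R N a i m) = if y.1 = i then prj R N y m else 0 := by
  obtain ⟨k, s⟩ := y
  split_ifs with hk
  · subst hk
    simp [blockProj]
  · simp [blockProj, Pi.single_eq_of_ne hk]

lemma isIdempotentElem_blockProj (i : ι) : IsIdempotentElem (blockProj R N a i) :=
  LinearMap.ext fun m => ext_prj (R := R) fun y => by
    rw [Module.End.mul_apply, prj_blockProj, prj_blockProj]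
    split_ifs <;> rfl

lemma commute_blockProj [Finite ι] {i : ι} (hfrom : ∀ k, k ≠ i → ∀ f : N i →ₗ[R] N k, f = 0)
    (hto : ∀ k, k ≠ i → ∀ f : N k →ₗ[R] N i, f = 0) (g : Module.End R (BigModule N a)) :
    Commute g (blockProj R N a i) := by
  refine linearMap_ext_inc fun z => LinearMap.ext fun x => ext_prj (R := R) fun y => ?_
  have hentry (h : ∀ f : N z.1 →ₗ[R] N y.1, f = 0) : prj R N y (g (inc R N z x)) = 0 :=
    LinearMap.congr_fun (h (prj R N y ∘ₗ g ∘ₗ inc R N z)) x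
  change prj R N y (g (blockProj R N a i (inc R N z x))) =
    prj R N y (blockProj R N a i (g (inc R N z x)))
  rw [blockProj_inc, prj_blockProj]
  split_ifs with hz hy hy
  · rfl
  · exact hentry (hz ▸ hfrom _ hy)
  · rw [map_zero, map_zero, hentry (hy ▸ hto _ hz)]
  · rw [map_zero, map_zero]

end BlockProj

lemma autSplits_of_hom_eq_zero [Finite ι] {a : ι → ℕ} (hN : ∀ i, IsIndecomposable R (N i))
    (ha : ∀ i, 0 < a i) {i j : ι}
    (hij : i ≠ j) (hfrom : ∀ k, k ≠ i → ∀ f : N i →ₗ[R] N k, f = 0)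
    (hto : ∀ k, k ≠ i → ∀ f : N k →ₗ[R] N i, f = 0) : AutSplits R (BigModule N a) := by
  classical
  have hinc (k : ι) : ∃ x, inc R N (⟨k, ⟨0, ha k⟩⟩ : Slot a) x ≠ 0 :=
    haveI := (hN k).1
    (exists_ne 0).imp fun x hx => (map_ne_zero_iff _ (inc_injective (R := R) _)).2 hx
  refine autSplits_of_forall_commute (isIdempotentElem_blockProj i) (commute_blockProj hfrom hto)
    (fun h => ?_) fun h => ?_
  · obtain ⟨x, hx⟩ := hinc i
    exact hx (by simpa [h] using (blockProj_inc (R := R) i ⟨i, ⟨0, ha i⟩⟩ x).symm)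
  · obtain ⟨x, hx⟩ := hinc j
    exact hx (by simpa [h, hij.symm] using blockProj_inc (R := R) i ⟨j, ⟨0, ha j⟩⟩ x)

end Shape

/-! ### The shift of a cycle -/

section Shift

variable {R : Type u} [Ring R] {ι : Type} {N : ι → Type v}
  [∀ i, AddCommGroup (N i)] [∀ i, Module R (N i)] {a : ι → ℕ}

namespace LongCycle

variable (c : LongCycle R N a)

/-- The slot of `N_{v_p}` corresponding to a slot of `N_{v_{p+1}}`. -/
abbrev pred (p : Fin c.k) (s : Fin (a (c.v p.succ))) : Slot a :=
  ⟨c.v p.castSucc, Fin.cast (c.mult_eq p).symm s⟩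

/-- The slots of `N_{v_{p+1}}`, where the shift takes its values. -/
abbrev tgt (p : Fin c.k) (s : Fin (a (c.v p.succ))) : Slot a := ⟨c.v p.succ, s⟩

lemma pred_injective (p : Fin c.k) : Function.Injective (c.pred p) := fun _ _ h =>
  Fin.cast_injective _ (eq_of_heq (Sigma.mk.inj h).2)

lemma pred_ne_pred {p q : Fin c.k} (h : p ≠ q) (s : Fin (a (c.v p.succ)))
    (t : Fin (a (c.v q.succ))) : c.pred p s ≠ c.pred q t := fun hst =>
  h (Fin.castSucc_injective _ (c.v_injective (congrArg Sigma.fst hst)))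

lemma tgt_injective (p : Fin c.k) : Function.Injective (c.tgt p) := fun _ _ h =>
  eq_of_heq (Sigma.mk.inj h).2

lemma tgt_ne_tgt {p q : Fin c.k} (h : p ≠ q) (s : Fin (a (c.v p.succ)))
    (t : Fin (a (c.v q.succ))) : c.tgt p s ≠ c.tgt q t := fun hst =>
  h (Fin.succ_injective _ (c.v_injective (congrArg Sigma.fst hst)))

lemma exists_eq_pred_or (y : Slot a) :
    (∃ p t, y = c.pred p t) ∨ ∀ p : Fin c.k, y.1 ≠ c.v p.castSucc := by
  refine or_iff_not_imp_right.2 fun h => ?_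
  push Not at h
  obtain ⟨p, hp⟩ := h
  obtain ⟨i, s⟩ := y
  obtain rfl : i = c.v p.castSucc := hp
  exact ⟨p, Fin.cast (c.mult_eq p) s, rfl⟩

lemma exists_eq_tgt_or (y : Slot a) :
    (∃ p t, y = c.tgt p t) ∨ ∀ p : Fin c.k, y.1 ≠ c.v p.succ := by
  refine or_iff_not_imp_right.2 fun h => ?_
  push Not at h
  obtain ⟨p, hp⟩ := h
  obtain ⟨i, s⟩ := y
  obtain rfl : i = c.v p.succ := hp
  exact ⟨p, s, rfl⟩

lemma apply_f_eq_zero (p : Fin c.k) {k : ι} {g : N (c.v p.succ) →ₗ[R] N k}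
    (hg : ¬ Function.Bijective g) (m : N (c.v p.castSucc)) : g (c.f p m) = 0 :=
  LinearMap.congr_fun ((c.isLeftMaximal p).2.2 k g hg) m

lemma exists_eq_comp_f [∀ i, Finite (N i)] (hN : ∀ i, IsIndecomposable R (N i)) (p : Fin c.k)
    {h : N (c.v p.castSucc) →ₗ[R] N (c.v p.succ)}
    (hh : h ∈ LM R N (c.v p.castSucc) (c.v p.succ)) :
    ∃ e : Module.End R (N (c.v p.succ)), h = e ∘ₗ c.f p := by
  let := residueDivisionRing (hN (c.v p.succ))
  have hone : Module.finrank (Residue R N (c.v p.succ))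
      (LM R N (c.v p.castSucc) (c.v p.succ)) = 1 := by
    have := c.numArrows_eq_one p.castSucc
    rwa [Fin.coeSucc_eq_succ] at this
  have hf : c.f p ∈ LM R N (c.v p.castSucc) (c.v p.succ) :=
    Submodule.subset_span (c.isLeftMaximal p)
  have hf0 : (⟨c.f p, hf⟩ : LM R N (c.v p.castSucc) (c.v p.succ)) ≠ 0 := fun h0 =>
    (c.isLeftMaximal p).1 (congrArg Subtype.val h0)
  obtain ⟨e, he⟩ := (finrank_eq_one_iff_of_nonzero' _ hf0).1 hone ⟨h, hh⟩
  obtain ⟨e, rfl⟩ := Ideal.Quotient.mk_surjective e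
  exact ⟨e, (congrArg Subtype.val he).symm⟩

/-- The only arrow of the graph that ends at `v_{p+1}`, `p < k`, is the one of the cycle. -/
def HasUniqueArrows : Prop :=
  ∀ (p : Fin c.k) (j : ι), j ≠ c.v p.castSucc → ∀ f ∈ LM R N j (c.v p.succ), f = 0

variable [DecidableEq ι]

lemma prj_shift (p : Fin c.k) (s : Fin (a (c.v p.succ))) (m : BigModule N a) :
    prj R N (c.tgt p s) (c.shift m) = c.f p (prj R N (c.pred p s) m) := by
  change (∑ q, blockMap (c.mult_eq q) (c.f q)) m (c.v p.succ) s =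
    c.f p (m (c.v p.castSucc) (Fin.cast (c.mult_eq p).symm s))
  rw [LinearMap.sum_apply, Finset.sum_apply, Finset.sum_apply, Finset.sum_eq_single p]
  · change (Pi.single (M := fun i => Fin (a i) → N i) (c.v p.succ) _) (c.v p.succ) s = _
    rw [Pi.single_eq_same]
    rfl
  · intro q _ hq
    change (Pi.single (M := fun i => Fin (a i) → N i) (c.v q.succ) _) (c.v p.succ) s = 0
    rw [Pi.single_eq_of_ne fun h => hq (Fin.succ_injective _ (c.v_injective h)).symm]
    rfl
  · simp

lemma prj_shift_of_ne {y : Slot a} (hy : ∀ p : Fin c.k, y.1 ≠ c.v p.succ) (m : BigModule N a) :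
    prj R N y (c.shift m) = 0 := by
  change (∑ q, blockMap (c.mult_eq q) (c.f q)) m y.1 y.2 = 0
  rw [LinearMap.sum_apply, Finset.sum_apply, Finset.sum_apply]
  refine Finset.sum_eq_zero fun q _ => ?_
  change (Pi.single (M := fun i => Fin (a i) → N i) (c.v q.succ) _) y.1 y.2 = 0
  rw [Pi.single_eq_of_ne (hy q)]
  rfl

lemma shift_inc (p : Fin c.k) (s : Fin (a (c.v p.succ))) (m : N (c.v p.castSucc)) :
    c.shift (inc R N (c.pred p s) m) = inc R N (c.tgt p s) (c.f p m) := by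
  refine ext_prj (R := R) fun y => ?_
  rcases c.exists_eq_tgt_or y with ⟨q, t, rfl⟩ | hy
  · rw [prj_shift]
    by_cases hpq : q = p
    · subst hpq
      by_cases hst : t = s
      · subst hst
        rw [prj_inc_apply_self (c.pred q t), prj_inc_apply_self (c.tgt q t)]
      · rw [prj_inc_apply_of_ne fun h => hst (c.pred_injective q h),
          prj_inc_apply_of_ne fun h => hst (c.tgt_injective q h), map_zero]
    · rw [prj_inc_apply_of_ne (c.pred_ne_pred hpq t s), prj_inc_apply_of_ne (c.tgt_ne_tgt hpq t s),
        map_zero]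
  · rw [c.prj_shift_of_ne hy, prj_inc_apply_of_ne fun h => hy p (congrArg Sigma.fst h)]

lemma shift_inc_of_ne {y : Slot a} (hy : ∀ p : Fin c.k, y.1 ≠ c.v p.castSucc) (m : N y.1) :
    c.shift (inc R N y m) = 0 := by
  refine ext_prj (R := R) fun z => ?_
  rw [map_zero]
  rcases c.exists_eq_tgt_or z with ⟨q, t, rfl⟩ | hz
  · rw [prj_shift, prj_inc_apply_of_ne fun h => hy q (congrArg Sigma.fst h).symm, map_zero]
  · rw [c.prj_shift_of_ne hz]

lemma exists_end_comp_inc_tgt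
    (φ : ∀ p : Fin c.k, Fin (a (c.v p.succ)) → N (c.v p.succ) →ₗ[R] BigModule N a) :
    ∃ s : Module.End R (BigModule N a), ∀ p t, s ∘ₗ inc R N (c.tgt p t) = φ p t := by
  refine ⟨∑ p, ∑ t, φ p t ∘ₗ prj R N (c.tgt p t), fun p t => LinearMap.ext fun m => ?_⟩
  rw [LinearMap.comp_apply, LinearMap.sum_apply, Finset.sum_eq_single p, LinearMap.sum_apply,
    Finset.sum_eq_single t]
  · rw [LinearMap.comp_apply, prj_inc_apply_self (c.tgt p t)]
  · intro t' _ ht'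
    rw [LinearMap.comp_apply, prj_inc_apply_of_ne fun h => ht' (c.tgt_injective p h), map_zero]
  · simp
  · intro q _ hq
    rw [LinearMap.sum_apply]
    refine Finset.sum_eq_zero fun t' _ => ?_
    rw [LinearMap.comp_apply, prj_inc_apply_of_ne (c.tgt_ne_tgt hq t' t), map_zero]
  · simp

variable [Finite ι]

lemma mem_span_shift_of_comp_inc {u : Module.End R (BigModule N a)}
    (hpred : ∀ p t, ∃ φ, u ∘ₗ inc R N (c.pred p t) = φ ∘ₗ c.f p)
    (hzero : ∀ z : Slot a, (∀ p : Fin c.k, z.1 ≠ c.v p.castSucc) → u ∘ₗ inc R N z = 0) :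
    u ∈ Ideal.span {c.shift} := by
  choose φ hφ using hpred
  obtain ⟨s, hs⟩ := c.exists_end_comp_inc_tgt φ
  refine Ideal.mem_span_singleton'.2 ⟨s, linearMap_ext_inc fun z => ?_⟩
  rcases c.exists_eq_pred_or z with ⟨p, t, rfl⟩ | hz
  · rw [hφ, ← hs]
    exact LinearMap.ext fun m => congrArg s (c.shift_inc p t m)
  · rw [hzero z hz]
    exact LinearMap.ext fun m => (congrArg s (c.shift_inc_of_ne hz m)).trans (map_zero s)

variable [∀ i, Finite (N i)]

lemma mem_span_shift_of_entries (hN : ∀ i, IsIndecomposable R (N i))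
    {u : Module.End R (BigModule N a)}
    (hzero : ∀ y z : Slot a, (∀ p : Fin c.k, y.1 = c.v p.succ → z.1 ≠ c.v p.castSucc) →
      prj R N y ∘ₗ u ∘ₗ inc R N z = 0)
    (hLM : ∀ p s t, prj R N (c.tgt p s) ∘ₗ u ∘ₗ inc R N (c.pred p t) ∈
      LM R N (c.v p.castSucc) (c.v p.succ)) : u ∈ Ideal.span {c.shift} := by
  have := Fintype.ofFinite ι
  refine c.mem_span_shift_of_comp_inc (fun p t => ?_) fun z hz =>
    LinearMap.ext fun m => ext_prj (R := R) fun y => ?_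
  · have hentry (y : Slot a) : ∃ e : N (c.v p.succ) →ₗ[R] N y.1,
        prj R N y ∘ₗ u ∘ₗ inc R N (c.pred p t) = e ∘ₗ c.f p := by
      by_cases hy : y.1 = c.v p.succ
      · obtain ⟨i, s⟩ := y
        obtain rfl : i = c.v p.succ := hy
        exact c.exists_eq_comp_f hN p (hLM p s t)
      · refine ⟨0, (hzero y (c.pred p t) fun q hq hq' => hy ?_).trans (LinearMap.zero_comp _).symm⟩
        rw [hq, Fin.castSucc_injective _ (c.v_injective hq')]
    choose e he using hentry
    refine ⟨∑ y, inc R N y ∘ₗ e y, LinearMap.ext fun m => ?_⟩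
    rw [LinearMap.comp_apply, ← sum_inc_prj_apply (R := R) (u _), LinearMap.comp_apply,
      LinearMap.sum_apply]
    exact Finset.sum_congr rfl fun y _ => congrArg (inc R N y) (LinearMap.congr_fun (he y) m)
  · exact (LinearMap.congr_fun (hzero y z fun p _ => hz p) m).trans (map_zero _).symm

lemma shift_mul_mem_span (hN : ∀ i, IsIndecomposable R (N i)) (hc : c.HasUniqueArrows)
    (t : Module.End R (BigModule N a)) : c.shift * t ∈ Ideal.span {c.shift} := by
  have hLM (p s) (z : Slot a) :
      prj R N (c.tgt p s) ∘ₗ (c.shift * t) ∘ₗ inc R N z ∈ LM R N z.1 (c.v p.succ) := by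
    have h : prj R N (c.tgt p s) ∘ₗ (c.shift * t) ∘ₗ inc R N z =
        c.f p ∘ₗ (prj R N (c.pred p s) ∘ₗ t ∘ₗ inc R N z) :=
      LinearMap.ext fun m => c.prj_shift p s _
    rw [h, mem_LM_iff hN]
    refine ⟨not_bijective_comp_left hN (c.isLeftMaximal p).2.1 _, fun k g hg => ?_⟩
    rw [← LinearMap.comp_assoc, (c.isLeftMaximal p).2.2 k g hg, LinearMap.zero_comp]
  refine c.mem_span_shift_of_entries hN (fun y z hyz => ?_) fun p s t => hLM p s (c.pred p t)
  rcases c.exists_eq_tgt_or y with ⟨p, s, rfl⟩ | hy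
  · exact hc p z.1 (hyz p rfl) _ (hLM p s z)
  · exact LinearMap.ext fun m => c.prj_shift_of_ne hy _

end LongCycle

end Shift

/-! ### The trace character of a cycle -/

section CycleCharacter

variable {R : Type u} [Ring R] {ι : Type} {N : ι → Type v}
  [∀ i, AddCommGroup (N i)] [∀ i, Module R (N i)] {a : ι → ℕ} [DecidableEq ι]

namespace LongCycle

variable (c : LongCycle R N a)

/-- The trace of the block from `N_{v_p}` to `N_{v_{p+1}}`. -/
def blockTrace (p : Fin c.k) :
    Module.End R (BigModule N a) →+ (N (c.v p.castSucc) →ₗ[R] N (c.v p.succ)) :=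
  AddMonoidHom.mk' (fun u => ∑ t, prj R N (c.tgt p t) ∘ₗ u ∘ₗ inc R N (c.pred p t)) fun u w => by
    rw [← Finset.sum_add_distrib]
    refine Finset.sum_congr rfl fun t _ => ?_
    rw [LinearMap.add_comp, LinearMap.comp_add]

lemma blockTrace_apply (p : Fin c.k) (u : Module.End R (BigModule N a)) (m : N (c.v p.castSucc)) :
    c.blockTrace p u m = ∑ t, prj R N (c.tgt p t) (u (inc R N (c.pred p t) m)) :=
  LinearMap.sum_apply _ _ _

lemma prj_apply_inc_f_eq_zero (hne : ∀ i j, i ≠ j → IsEmpty (N i ≃ₗ[R] N j)) (p : Fin c.k)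
    {y : Slot a} (hy : y.1 ≠ c.v p.succ) (w : Module.End R (BigModule N a))
    (t : Fin (a (c.v p.succ))) (m : N (c.v p.castSucc)) :
    prj R N y (w (inc R N (c.tgt p t) (c.f p m))) = 0 :=
  c.apply_f_eq_zero p (g := prj R N y ∘ₗ w ∘ₗ inc R N (c.tgt p t))
    (fun hb => (hne _ _ hy.symm).false (LinearEquiv.ofBijective _ hb)) m

lemma apply_inc_f_eq_sum [Finite ι] (hne : ∀ i j, i ≠ j → IsEmpty (N i ≃ₗ[R] N j)) (p : Fin c.k)
    (w : Module.End R (BigModule N a)) (t : Fin (a (c.v p.succ))) (m : N (c.v p.castSucc)) :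
    w (inc R N (c.tgt p t) (c.f p m)) =
      ∑ t', inc R N (c.tgt p t') (prj R N (c.tgt p t') (w (inc R N (c.tgt p t) (c.f p m)))) := by
  have := Fintype.ofFinite ι
  conv_lhs => rw [← sum_inc_prj_apply (R := R) (w _)]
  rw [Fintype.sum_sigma, Finset.sum_eq_single (c.v p.succ)]
  · intro i _ hi
    refine Finset.sum_eq_zero fun s _ => ?_
    rw [c.prj_apply_inc_f_eq_zero hne p (y := ⟨i, s⟩) hi, map_zero]
  · simp

/-- The entries of `s` and `w` commute up to non-bijective maps, which kill `f_p`. -/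
lemma blockTrace_mul_comm [Finite ι] [∀ i, Finite (N i)] (hN : ∀ i, IsIndecomposable R (N i))
    (hne : ∀ i j, i ≠ j → IsEmpty (N i ≃ₗ[R] N j)) (p : Fin c.k)
    (s w : Module.End R (BigModule N a)) :
    c.blockTrace p (s * w * c.shift) = c.blockTrace p (w * s * c.shift) := by
  have hentries (s w : Module.End R (BigModule N a)) (m) : c.blockTrace p (s * w * c.shift) m =
      ∑ t, ∑ t', (prj R N (c.tgt p t) ∘ₗ s ∘ₗ inc R N (c.tgt p t'))
        ((prj R N (c.tgt p t') ∘ₗ w ∘ₗ inc R N (c.tgt p t)) (c.f p m)) := by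
    rw [blockTrace_apply]
    refine Finset.sum_congr rfl fun t _ => ?_
    rw [Module.End.mul_apply, shift_inc, Module.End.mul_apply, c.apply_inc_f_eq_sum hne p w,
      map_sum, map_sum]
    rfl
  refine LinearMap.ext fun m => ?_
  rw [hentries, hentries, Finset.sum_comm]
  refine Finset.sum_congr rfl fun t _ => Finset.sum_congr rfl fun t' _ => ?_
  exact sub_eq_zero.1 (c.apply_f_eq_zero p (not_bijective_commutator (hN (c.v p.succ))
    (prj R N (c.tgt p t') ∘ₗ s ∘ₗ inc R N (c.tgt p t))
    (prj R N (c.tgt p t) ∘ₗ w ∘ₗ inc R N (c.tgt p t'))) m)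

lemma exists_blockTrace_mul_eq (w : Module.End R (BigModule N a)) {p : Fin c.k}
    {t t₀ : Fin (a (c.v p.succ))}
    (hb : Function.Bijective (prj R N (c.tgt p t₀) ∘ₗ w ∘ₗ inc R N (c.tgt p t))) :
    ∃ s : Module.End R (BigModule N a), c.blockTrace p (s * (w * c.shift)) = c.f p ∧
      ∀ q ≠ p, c.blockTrace q (s * (w * c.shift)) = 0 := by
  let e := LinearEquiv.ofBijective _ hb
  refine ⟨inc R N (c.tgt p t) ∘ₗ e.symm.toLinearMap ∘ₗ prj R N (c.tgt p t₀),
    LinearMap.ext fun m => ?_, fun q hq => LinearMap.ext fun m => ?_⟩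
  · rw [blockTrace_apply, Finset.sum_eq_single t]
    · change prj R N (c.tgt p t) (inc R N (c.tgt p t) (e.symm (prj R N (c.tgt p t₀)
        (w (c.shift (inc R N (c.pred p t) m)))))) = _
      rw [prj_inc_apply_self (c.tgt p t), shift_inc]
      exact e.symm_apply_apply _
    · exact fun t' _ ht' => prj_inc_apply_of_ne (fun h => ht' (c.tgt_injective p h)) _
    · simp
  · rw [blockTrace_apply]
    exact Finset.sum_eq_zero fun t' _ => prj_inc_apply_of_ne (c.tgt_ne_tgt hq t' t) _

lemma exists_blockTrace_mul_eq_of_mul_shift_ne_zero [Finite ι]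
    (hne : ∀ i j, i ≠ j → IsEmpty (N i ≃ₗ[R] N j)) {w : Module.End R (BigModule N a)}
    (hw : w * c.shift ≠ 0) : ∃ (s : Module.End R (BigModule N a)) (p : Fin c.k),
      c.blockTrace p (s * (w * c.shift)) = c.f p ∧
        ∀ q ≠ p, c.blockTrace q (s * (w * c.shift)) = 0 := by
  contrapose! hw
  refine linearMap_ext_inc fun z => LinearMap.ext fun m => ?_
  change w (c.shift (inc R N z m)) = 0
  rcases c.exists_eq_pred_or z with ⟨p, t, rfl⟩ | hz
  swap
  · rw [c.shift_inc_of_ne hz, map_zero]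
  rw [shift_inc]
  refine ext_prj (R := R) fun y => ?_
  rw [map_zero]
  by_cases hy : y.1 = c.v p.succ
  swap
  · exact c.prj_apply_inc_f_eq_zero hne p hy w t m
  obtain ⟨i, t₀⟩ := y
  obtain rfl : i = c.v p.succ := hy
  refine c.apply_f_eq_zero p (g := prj R N (c.tgt p t₀) ∘ₗ w ∘ₗ inc R N (c.tgt p t))
    (fun hb => ?_) m
  obtain ⟨s, hp, hq⟩ := c.exists_blockTrace_mul_eq w hb
  obtain ⟨q, hqp, h⟩ := hw s p hp
  exact h (hq q hqp)

variable (K : Type*) [Field K] [IsAlgClosed K] [CharZero K]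

lemma exists_isTraceCharacter [Finite ι] [∀ i, Finite (N i)] (hN : ∀ i, IsIndecomposable R (N i))
    (hne : ∀ i j, i ≠ j → IsEmpty (N i ≃ₗ[R] N j)) (hc : c.HasUniqueArrows) :
    ∃ χ : AddChar (Module.End R (BigModule N a)) K, IsTraceCharacter c.shift χ := by
  choose ψ hψ using fun p => exists_addChar_ne_one K (c.isLeftMaximal p).1
  let χ : AddChar (Module.End R (BigModule N a)) K :=
    ∏ p, (ψ p).compAddMonoidHom (c.blockTrace p)
  have hχ (u) : χ u = ∏ p, ψ p (c.blockTrace p u) := AddChar.prod_apply _ _ _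
  refine ⟨χ, c.shift_mul_mem_span hN hc, fun s t => ?_, fun u hu => ?_⟩
  · rw [hχ, hχ]
    exact Finset.prod_congr rfl fun p _ => by rw [c.blockTrace_mul_comm hN hne]
  · obtain ⟨w, hw⟩ := Ideal.mem_span_singleton'.1 u.2
    by_contra hu0
    obtain ⟨s, p, hp, hq⟩ := c.exists_blockTrace_mul_eq_of_mul_shift_ne_zero hne (w := w)
      fun h => hu0 (Subtype.ext (hw.symm.trans h))
    have hs : χ (s * (w * c.shift)) = 1 := by rw [hw]; exact hu s
    rw [hχ, Finset.prod_eq_single p, hp] at hs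
    · exact hψ p hs
    · intro q _ hqp
      rw [hq q hqp, AddChar.map_zero_eq_one]
    · simp

end LongCycle

end CycleCharacter

/-! ### Generators of the ideal of the shift are conjugate -/

lemma span_conj_eq_span {E : Type*} [Ring E] {x y : E} [(Ideal.span {x}).IsTwoSided]
    (hy : Ideal.span {y} = Ideal.span {x}) (g : Eˣ) :
    Ideal.span {(g * y * (g⁻¹ : Eˣ) : E)} = Ideal.span {x} := by
  have hyx : y ∈ Ideal.span {x} := hy ▸ Ideal.mem_span_singleton_self y
  refine le_antisymm ((Ideal.span_singleton_le_iff_mem _).2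
    (Ideal.mul_mem_right _ _ (Ideal.mul_mem_left _ _ hyx)))
    ((Ideal.span_singleton_le_iff_mem _).2 ?_)
  have hxg : x * g ∈ Ideal.span {y} :=
    hy ▸ Ideal.mul_mem_right _ _ (Ideal.mem_span_singleton_self x)
  obtain ⟨r, hr⟩ := Ideal.mem_span_singleton'.1 hxg
  refine Ideal.mem_span_singleton'.2 ⟨r * (g⁻¹ : Eˣ), ?_⟩
  rw [← mul_assoc, ← mul_assoc, mul_assoc r, Units.inv_mul, mul_one, hr, Units.mul_inv_cancel_right]

section Conjugate

variable {R : Type u} [Ring R] {ι : Type} {N : ι → Type v}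
  [∀ i, AddCommGroup (N i)] [∀ i, Module R (N i)] {a : ι → ℕ} [DecidableEq ι]

/-- The endomorphism acting on `Nᵢ ^ aᵢ` by the diagonal block of `b` and fixing the other
summands. -/
def diagBlock (i : ι) (b : Module.End R (BigModule N a)) : Module.End R (BigModule N a) :=
  1 - blockProj R N a i + blockProj R N a i * b * blockProj R N a i

lemma diagBlock_inc_of_ne {i : ι} (b : Module.End R (BigModule N a)) {y : Slot a} (hy : y.1 ≠ i)
    (m : N y.1) : diagBlock i b (inc R N y m) = inc R N y m := by
  change inc R N y m - blockProj R N a i _ + blockProj R N a i (b (blockProj R N a i _)) = _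
  rw [blockProj_inc, if_neg hy, map_zero, map_zero, sub_zero, add_zero]

lemma diagBlock_apply {i : ι} (b : Module.End R (BigModule N a)) {m : BigModule N a}
    (hm : blockProj R N a i m = m) : diagBlock i b m = blockProj R N a i (b m) := by
  change m - blockProj R N a i m + blockProj R N a i (b (blockProj R N a i m)) = _
  rw [hm, sub_self, zero_add]

namespace LongCycle

variable (c : LongCycle R N a) [Finite ι]

lemma blockProj_apply_shift_inc (hne : ∀ i j, i ≠ j → IsEmpty (N i ≃ₗ[R] N j)) (p : Fin c.k)
    (w : Module.End R (BigModule N a)) (t : Fin (a (c.v p.succ))) (m : N (c.v p.castSucc)) :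
    blockProj R N a (c.v p.succ) (w (c.shift (inc R N (c.pred p t) m))) =
      w (c.shift (inc R N (c.pred p t) m)) := by
  rw [shift_inc, c.apply_inc_f_eq_sum hne p w, map_sum]
  exact Finset.sum_congr rfl fun t' _ => (blockProj_inc _ (c.tgt p t') _).trans (if_pos rfl)

variable [∀ i, Finite (N i)]

/-- The entries of `1 - h h'`, where `h` and `h'` are the diagonal blocks of `s` and `s'`, kill
`f_p`, hence are not bijective. -/
lemma isUnit_diagBlock (hN : ∀ i, IsIndecomposable R (N i))
    (hne : ∀ i j, i ≠ j → IsEmpty (N i ≃ₗ[R] N j)) {s s' : Module.End R (BigModule N a)}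
    (hs : s * (s' * c.shift) = c.shift) (p : Fin c.k) : IsUnit (diagBlock (c.v p.succ) s) := by
  have hnt := fun i => (hN i).1
  let h := diagBlock (c.v p.succ) s
  let h' := diagBlock (c.v p.succ) s'
  have hh' (t m) : h (h' (c.shift (inc R N (c.pred p t) m))) =
      c.shift (inc R N (c.pred p t) m) := by
    have hblock := c.blockProj_apply_shift_inc hne p
    have hone : blockProj R N a (c.v p.succ) (c.shift (inc R N (c.pred p t) m)) =
      c.shift (inc R N (c.pred p t) m) := hblock 1 t m
    change diagBlock _ s (diagBlock _ s' _) = _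
    rw [diagBlock_apply s' hone, hblock s' t m, diagBlock_apply s (hblock s' t m)]
    exact (congrArg _ (LinearMap.congr_fun hs _)).trans hone
  have hbij : Function.Bijective (1 - (1 - h * h') : Module.End R (BigModule N a)) := by
    refine bijective_one_sub_of_entries hN _ fun y z hb => ?_
    by_cases hz : z.1 = c.v p.succ
    · obtain ⟨i, t⟩ := z
      obtain rfl : i = c.v p.succ := hz
      refine (c.isLeftMaximal p).1 (LinearMap.ext fun m => hb.1 ?_)
      change prj R N y (inc R N (c.tgt p t) (c.f p m) - h (h' (inc R N (c.tgt p t) (c.f p m)))) = _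
      rw [← shift_inc, hh', sub_self, map_zero, LinearMap.zero_apply, map_zero]
    · refine not_bijective_zero (R := R) (X := N z.1) (Y := N y.1) ?_
      convert hb using 2
      refine LinearMap.ext fun m => ?_
      change 0 = prj R N y (inc R N z m - h (h' (inc R N z m)))
      rw [diagBlock_inc_of_ne s' hz, diagBlock_inc_of_ne s hz, sub_self, map_zero]
  rw [sub_sub_cancel] at hbij
  exact (Module.End.isUnit_iff h).2 (Finite.surjective_iff_bijective.1
    (Function.Surjective.of_comp (g := h') hbij.2))

lemma exists_unit_apply_eq_shift (hN : ∀ i, IsIndecomposable R (N i))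
    (hne : ∀ i j, i ≠ j → IsEmpty (N i ≃ₗ[R] N j)) {y : Module.End R (BigModule N a)}
    (hy : Ideal.span {y} = Ideal.span {c.shift}) (p : Fin c.k) :
    ∃ g : (Module.End R (BigModule N a))ˣ,
      (∀ z : Slot a, z.1 ≠ c.v p.succ → ∀ m, g.1 (inc R N z m) = inc R N z m) ∧
      ∀ t m, g.1 (y (inc R N (c.pred p t) m)) = c.shift (inc R N (c.pred p t) m) := by
  obtain ⟨s', rfl⟩ := Ideal.mem_span_singleton'.1 (hy ▸ Ideal.mem_span_singleton_self y)
  obtain ⟨s, hs⟩ := Ideal.mem_span_singleton'.1 (hy.symm ▸ Ideal.mem_span_singleton_self c.shift)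
  refine ⟨(c.isUnit_diagBlock hN hne hs p).unit, fun z => diagBlock_inc_of_ne s, fun t m => ?_⟩
  have hblock := c.blockProj_apply_shift_inc hne p
  refine (diagBlock_apply s (hblock s' t m)).trans ?_
  exact (congrArg _ (LinearMap.congr_fun hs _)).trans (hblock 1 t m)

/-- Changing the map on `N_{v_{p+1}}` affects the columns of `y` before `p` only through their
values, which are fixed since they lie in other summands. -/
lemma exists_conj_comp_inc_pred (hN : ∀ i, IsIndecomposable R (N i))
    (hne : ∀ i j, i ≠ j → IsEmpty (N i ≃ₗ[R] N j)) {y : Module.End R (BigModule N a)}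
    (hy : Ideal.span {y} = Ideal.span {c.shift}) (p : Fin c.k)
    (hlt : ∀ q < p, ∀ t m, y (inc R N (c.pred q t) m) = c.shift (inc R N (c.pred q t) m)) :
    ∃ g : (Module.End R (BigModule N a))ˣ, ∀ q ≤ p, ∀ t m,
      (g * y * (g⁻¹ : (Module.End R (BigModule N a))ˣ) : Module.End R (BigModule N a))
        (inc R N (c.pred q t) m) = c.shift (inc R N (c.pred q t) m) := by
  obtain ⟨g, hfix, hg⟩ := c.exists_unit_apply_eq_shift hN hne hy p
  have hinv (z : Slot a) (hz : z.1 ≠ c.v p.succ) (m) :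
      (g⁻¹ : (Module.End R (BigModule N a))ˣ).1 (inc R N z m) = inc R N z m := by
    conv_lhs => rw [← hfix z hz m]
    exact LinearMap.congr_fun g.inv_mul _
  refine ⟨g, fun q hq t m => ?_⟩
  rw [Module.End.mul_apply, hinv (c.pred q t), Module.End.mul_apply]
  · rcases hq.lt_or_eq with hlt' | rfl
    · rw [hlt q hlt', shift_inc]
      exact hfix (c.tgt q t) (c.v_injective.ne (Fin.succ_injective _ |>.ne hlt'.ne)) _
    · exact hg t m
  · exact c.v_injective.ne (Fin.castSucc_lt_succ_iff.2 hq).ne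

lemma exists_semiconjBy_shift (hN : ∀ i, IsIndecomposable R (N i))
    (hne : ∀ i j, i ≠ j → IsEmpty (N i ≃ₗ[R] N j)) (hc : c.HasUniqueArrows)
    {y : Module.End R (BigModule N a)} (hy : Ideal.span {y} = Ideal.span {c.shift}) :
    ∃ g : (Module.End R (BigModule N a))ˣ, SemiconjBy g.1 c.shift y := by
  have : (Ideal.span {c.shift}).IsTwoSided := isTwoSided_span (c.shift_mul_mem_span hN hc)
  have hstep (k : ℕ) (hk : k ≤ c.k) : ∃ g : (Module.End R (BigModule N a))ˣ,
      ∀ q : Fin c.k, q.val < k → ∀ t m,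
        (g * y * (g⁻¹ : (Module.End R (BigModule N a))ˣ) : Module.End R (BigModule N a))
          (inc R N (c.pred q t) m) = c.shift (inc R N (c.pred q t) m) := by
    induction k with
    | zero => exact ⟨1, fun q hq => absurd hq (Nat.not_lt_zero _)⟩
    | succ k ih =>
      obtain ⟨g, hg⟩ := ih (Nat.le_of_succ_le hk)
      obtain ⟨g', hg'⟩ :=
        c.exists_conj_comp_inc_pred hN hne (span_conj_eq_span hy g) ⟨k, hk⟩ fun q hq => hg q hq
      refine ⟨g' * g, fun q hq t m => ?_⟩
      rw [← hg' q (Nat.le_of_lt_succ hq), mul_inv_rev, Units.val_mul, Units.val_mul]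
      simp only [mul_assoc]
  obtain ⟨g, hg⟩ := hstep c.k le_rfl
  have hshift : (g * y * (g⁻¹ : (Module.End R (BigModule N a))ˣ) : Module.End R (BigModule N a)) =
      c.shift := by
    refine linearMap_ext_inc fun z => LinearMap.ext fun m => ?_
    rcases c.exists_eq_pred_or z with ⟨p, t, rfl⟩ | hz
    · exact hg p p.2 t m
    · obtain ⟨r, hr⟩ := Ideal.mem_span_singleton'.1
        (span_conj_eq_span hy g ▸ Ideal.mem_span_singleton_self _)
      rw [← hr, LinearMap.comp_apply, LinearMap.comp_apply, Module.End.mul_apply,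
        c.shift_inc_of_ne hz, map_zero]
  refine ⟨g⁻¹, ?_⟩
  rw [SemiconjBy, ← hshift, ← mul_assoc, ← mul_assoc, Units.inv_mul, one_mul]

end LongCycle

end Conjugate

/-! ### Automorphisms of the module over the auxiliary ring -/

section TildeAut

variable {R : Type u} [Ring R] {X : Type v} [AddCommGroup X] [Module R X]

/-- The automorphisms commuting with an endomorphism `t`, that is, compatible with the action of
`x` as `t`. -/
def autCentralizer (t : X →ₗ[R] X) : Subgroup (X ≃ₗ[R] X) where
  carrier := {g | ∀ m, g (t m) = t (g m)}
  one_mem' _ := rfl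
  mul_mem' {g h} hg hh m := by
    rw [LinearEquiv.mul_apply, LinearEquiv.mul_apply, hh, hg]
  inv_mem' {g} hg m := by
    apply g.injective
    rw [hg]
    exact (g.apply_symm_apply _).trans (congrArg t (g.apply_symm_apply m).symm)

variable (t : X →ₗ[R] X) (ht : t ∘ₗ t = 0)

lemma tildeHom_comm (φ : X →+ X) (hR : ∀ (r : R) m, φ (r • m) = r • φ m)
    (hφ : ∀ m, φ (t m) = t (φ m)) (z : RTilde R) (m : X) :
    φ (tildeHom t ht z m) = tildeHom t ht z (φ m) := by
  have hw (w : FreeBimodule R) : φ (bimoduleAct t w m) = bimoduleAct t w (φ m) := by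
    induction w using FreeBimodule.induction with
    | h0 => simp
    | hm b₁ b₂ => rw [bimoduleAct_mk, bimoduleAct_mk, hR, hφ, hR]
    | ha y z hy hz =>
      rw [map_add]
      change φ (bimoduleAct t y m + bimoduleAct t z m) =
        bimoduleAct t y (φ m) + bimoduleAct t z (φ m)
      rw [map_add, hy, hz]
  change φ (z.fst • m + bimoduleAct t z.snd m) = z.fst • φ m + bimoduleAct t z.snd (φ m)
  rw [map_add, hR, hw]

lemma tildeHom_inl (r : R) (m : X) : tildeHom t ht (TrivSqZeroExt.inl r) m = r • m := by
  change r • m + bimoduleAct t 0 m = r • m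
  rw [map_zero]
  exact add_zero _

lemma tildeHom_inr (m : X) :
    tildeHom t ht (TrivSqZeroExt.inr (FreeBimodule.mk 1 1)) m = t m := by
  change (0 : R) • m + bimoduleAct t (FreeBimodule.mk 1 1) m = t m
  rw [bimoduleAct_mk, zero_smul, zero_add, one_smul, one_smul]

lemma comm_of_tildeHom_comm (φ : X → X)
    (h : ∀ z m, φ (tildeHom t ht z m) = tildeHom t ht z (φ m)) :
    (∀ (r : R) m, φ (r • m) = r • φ m) ∧ ∀ m, φ (t m) = t (φ m) := by
  refine ⟨fun r m => ?_, fun m => ?_⟩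
  · rw [← tildeHom_inl t ht, h, tildeHom_inl]
  · rw [← tildeHom_inr t ht, h, tildeHom_inr]

/-- The identification of the automorphisms commuting with `t` with the `R̃`-automorphisms of the
module on which `x` acts as `t`. -/
def autCentralizerEquiv :
    autCentralizer t ≃* (TildeModule t ht ≃ₗ[RTilde R] TildeModule t ht) where
  toFun g :=
    { toFun := fun m => g.1 m
      map_add' := fun m m' => map_add g.1 m m'
      map_smul' := fun z m =>
        tildeHom_comm t ht (g.1 : X →+ X) (fun r m => map_smul g.1 r m) g.2 z m
      invFun := fun m => g.1.symm m
      left_inv := g.1.symm_apply_apply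
      right_inv := g.1.apply_symm_apply }
  invFun φ :=
    ⟨{ toFun := fun m => φ m
       map_add' := fun m m' => φ.map_add m m'
       map_smul' := (comm_of_tildeHom_comm t ht φ φ.map_smul).1
       invFun := fun m => φ.symm m
       left_inv := φ.symm_apply_apply
       right_inv := φ.apply_symm_apply }, (comm_of_tildeHom_comm t ht φ φ.map_smul).2⟩
  left_inv _ := rfl
  right_inv _ := rfl
  map_mul' _ _ := rfl

end TildeAut

/-! ### Induction from the centralizer of the shift -/

section CycleInduction

variable {R : Type u} [Ring R] {ι : Type} {N : ι → Type v} [∀ i, AddCommGroup (N i)]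
  [∀ i, Module R (N i)] {a : ι → ℕ}

lemma LongCycle.not_commute_inc_comp_prj [DecidableEq ι] (c : LongCycle R N a) {p : Fin c.k}
    (hp : p.castSucc = 0) (s t : Fin (a (c.v p.castSucc))) {d : Module.End R (N (c.v p.castSucc))}
    (hd : Function.Surjective d) :
    ¬ Commute (inc R N ⟨c.v p.castSucc, s⟩ ∘ₗ d ∘ₗ prj R N ⟨c.v p.castSucc, t⟩ :
      Module.End R (BigModule N a)) c.shift := by
  intro hcomm
  refine (c.isLeftMaximal p).1 (LinearMap.ext fun n => ?_)
  obtain ⟨n, rfl⟩ := hd n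
  have hshift := LinearMap.congr_fun hcomm.eq (inc R N ⟨c.v p.castSucc, t⟩ n)
  simp only [Module.End.mul_apply, LinearMap.comp_apply,
    prj_inc_apply_self (⟨c.v p.castSucc, t⟩ : Slot a)] at hshift
  rw [c.prj_shift_of_ne (y := ⟨c.v p.castSucc, t⟩) (fun q hq => Fin.succ_ne_zero q
      ((c.v_injective hq).symm.trans hp)), map_zero, map_zero] at hshift
  exact inc_injective (R := R) (c.tgt p (Fin.cast (c.mult_eq p) s))
    ((c.shift_inc p _ (d n)).symm.trans (hshift.symm.trans (map_zero _).symm))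

variable [∀ i, Finite (N i)]

lemma exists_bijective_one_add {j : ι} (hj : IsIndecomposable R (N j))
    (hcard : Nat.card (Residue R N j) ≠ 2) :
    ∃ d : Module.End R (N j), Function.Bijective d ∧
      Function.Bijective (1 + d : Module.End R (N j)) := by
  let := residueDivisionRing hj
  obtain ⟨r, hr0, hr1⟩ : ∃ r : Residue R N j, r ≠ 0 ∧ r ≠ 1 := by
    by_contra! hcon
    refine hcard (Nat.card_eq_two_iff.2 ⟨0, 1, zero_ne_one, Set.eq_univ_of_forall fun r => ?_⟩)
    exact or_iff_not_imp_left.2 (hcon r)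
  obtain ⟨e, rfl⟩ := Ideal.Quotient.mk_surjective r
  refine ⟨e - 1, ?_, ?_⟩
  · by_contra h
    exact hr1 (Ideal.Quotient.eq.2 ((mem_jacobson_end_iff hj).2 h))
  · rw [add_sub_cancel]
    by_contra h
    exact hr0 (Ideal.Quotient.eq_zero_iff_mem.2 ((mem_jacobson_end_iff hj).2 h))

variable [Finite ι]

section Transvection

variable [DecidableEq ι]

lemma isUnit_one_add_inc_comp_prj {i : ι} {s t : Fin (a i)} {d : Module.End R (N i)}
    (hd : s = t → Function.Bijective (1 + d : Module.End R (N i))) :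
    IsUnit (1 + inc R N ⟨i, s⟩ ∘ₗ d ∘ₗ prj R N ⟨i, t⟩ : Module.End R (BigModule N a)) := by
  refine (Module.End.isUnit_iff _).2 (Finite.injective_iff_bijective.1 ?_)
  refine (injective_iff_map_eq_zero _).2 fun m hm => ?_
  have hm : m + inc R N ⟨i, s⟩ (d (prj R N ⟨i, t⟩ m)) = 0 := hm
  suffices ht : prj R N ⟨i, t⟩ m = 0 by rwa [ht, map_zero, map_zero, add_zero] at hm
  have hmt := congrArg (prj R N ⟨i, t⟩) hm
  rw [map_add, map_zero] at hmt
  by_cases hst : s = t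
  · subst hst
    rw [prj_inc_apply_self (⟨i, s⟩ : Slot a)] at hmt
    exact (hd rfl).1 (hmt.trans (map_zero _).symm)
  · rwa [prj_inc_apply_of_ne (fun h => hst (by simpa using h.symm)), add_zero] at hmt

lemma exists_isUnit_one_add_inc_comp_prj {i : ι} (hN : IsIndecomposable R (N i))
    (hi : 0 < a i) (h : ¬ (a i = 1 ∧ Nat.card (Residue R N i) = 2)) :
    ∃ (s t : Fin (a i)) (d : Module.End R (N i)), Function.Bijective d ∧
      IsUnit (1 + inc R N ⟨i, s⟩ ∘ₗ d ∘ₗ prj R N ⟨i, t⟩ : Module.End R (BigModule N a)) := by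
  by_cases hai : a i = 1
  · obtain ⟨d, hd, hd'⟩ := exists_bijective_one_add hN fun hcard => h ⟨hai, hcard⟩
    exact ⟨⟨0, hi⟩, ⟨0, hi⟩, d, hd, isUnit_one_add_inc_comp_prj fun _ => hd'⟩
  · exact ⟨⟨0, hi⟩, ⟨1, by omega⟩, 1, Function.bijective_id,
      isUnit_one_add_inc_comp_prj fun hst => by simp at hst⟩

end Transvection

namespace LongCycle

variable [DecidableEq ι] (c : LongCycle R N a)

lemma autCentralizer_shift_ne_top (hN : IsIndecomposable R (N (c.v 0))) (h0 : 0 < a (c.v 0))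
    (h : ¬ (a (c.v 0) = 1 ∧ Nat.card (Residue R N (c.v 0)) = 2)) :
    autCentralizer c.shift ≠ ⊤ := by
  let p : Fin c.k := ⟨0, c.one_le_k⟩
  obtain ⟨s, t, d, hd, g, hg⟩ := exists_isUnit_one_add_inc_comp_prj (i := c.v p.castSucc) hN h0 h
  intro htop
  have hmem : LinearMap.GeneralLinearGroup.generalLinearEquiv R (BigModule N a) g ∈
      autCentralizer c.shift := htop ▸ Subgroup.mem_top _
  have hcomm : Commute g.1 c.shift := LinearMap.ext hmem
  rw [hg] at hcomm
  refine c.not_commute_inc_comp_prj rfl s t hd.2 ?_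
  simpa only [add_sub_cancel_left] using hcomm.sub_left (Commute.one_left c.shift)

variable {K : Type*} [Field K] [IsAlgClosed K] [CharZero K] {V : Type*} [AddCommGroup V]
  [Module K V] {ρ : Representation K (BigModule N a ≃ₗ[R] BigModule N a) V}

lemma isInducedFrom_autCentralizer (hirr : ρ.IsIrreducible)
    (hρ : IsPrimitiveRep
      (ρ.comp (LinearMap.GeneralLinearGroup.generalLinearEquiv R (BigModule N a)).toMonoidHom))
    (hN : ∀ i, IsIndecomposable R (N i)) (hne : ∀ i j, i ≠ j → IsEmpty (N i ≃ₗ[R] N j))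
    (hc : c.HasUniqueArrows) : IsInducedFrom ρ (autCentralizer c.shift) := by
  obtain ⟨χ₀, hχ₀⟩ := c.exists_isTraceCharacter K hN hne hc
  exact isInducedFrom_of_isTraceCharacter _ hirr hρ c.shift_comp_shift hχ₀
    (fun y hy => c.exists_semiconjBy_shift hN hne hc hy)
    fun g => ⟨fun hg => LinearMap.ext hg, fun hg m => LinearMap.congr_fun hg.eq m⟩

end LongCycle

end CycleInduction

/-! ### Cycles of a permutation as cycles of the left maximal graph -/

section Permutation

variable {R : Type u} [Ring R] {ι : Type} {N : ι → Type v} [∀ i, AddCommGroup (N i)]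
  [∀ i, Module R (N i)] [∀ i, Finite (N i)] {a : ι → ℕ}

lemma exists_injective_cycle_of_perm {α : Type*} [Finite α] (s : Equiv.Perm α) {j : α}
    (hj : s j ≠ j) : ∃ (k : ℕ) (v : Fin (k + 1) → α), 1 ≤ k ∧ Function.Injective v ∧ v 0 = j ∧
      (∀ p : Fin k, v p.succ = s (v p.castSucc)) ∧ ∀ p, v (p + 1) = s (v p) := by
  have hper : j ∈ Function.periodicPts s := s.injective.mem_periodicPts j
  obtain ⟨k, hk⟩ : ∃ k, Function.minimalPeriod s j = k + 1 :=
    ⟨_, (Nat.sub_add_cancel (Function.minimalPeriod_pos_of_mem_periodicPts hper)).symm⟩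
  have hk1 : Function.minimalPeriod s j ≠ 1 := fun h =>
    hj (Function.minimalPeriod_eq_one_iff_isFixedPt.1 h)
  have hsucc (p : Fin k) : s^[p.succ] j = s (s^[p.castSucc] j) :=
    Function.iterate_succ_apply' s p j
  refine ⟨k, fun p => s^[p] j, by omega, fun p q hpq => Fin.ext ?_, rfl, hsucc, fun p => ?_⟩
  · have hmem (r : Fin (k + 1)) : (r : ℕ) ∈ Set.Iio (Function.minimalPeriod s j) :=
      r.2.trans_eq hk.symm
    exact Function.iterate_injOn_Iio_minimalPeriod (hmem p) (hmem q) hpq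
  · induction p using Fin.lastCases with
    | last =>
      rw [Fin.last_add_one]
      change j = s (s^[k] j)
      rw [← Function.iterate_succ_apply' s, Nat.succ_eq_add_one, ← hk,
        Function.iterate_minimalPeriod]
    | cast p => exact Fin.coeSucc_eq_succ (a := p) ▸ hsucc p

lemma exists_longCycle_of_perm [Finite ι] (hN : ∀ i, IsIndecomposable R (N i)) (s : Equiv.Perm ι)
    (hs : ∀ j, numArrows R N j (s j) = 1) (has : ∀ j, a (s j) = a j) {j : ι} (hj : s j ≠ j) :
    ∃ c : LongCycle R N a, c.v 0 = j ∧ ∀ p : Fin c.k, c.v p.succ = s (c.v p.castSucc) := by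
  obtain ⟨k, v, hk, hinj, hv0, hsucc, hadd⟩ := exists_injective_cycle_of_perm s hj
  have hf (p : Fin k) : ∃ f : N (v p.castSucc) →ₗ[R] N (v p.succ), IsLeftMaximal N f := by
    have harrow : numArrows R N (v p.castSucc) (v p.succ) ≠ 0 := by
      rw [hsucc, hs]
      exact one_ne_zero
    obtain ⟨f, hf, hf0⟩ := (numArrows_ne_zero_iff hN).1 harrow
    exact ⟨f, isLeftMaximal_of_mem_LM hN hf hf0⟩
  choose f hf using hf
  exact ⟨⟨k, hk, v, hinj, fun p => by rw [hadd, hs], f, hf, fun p => by rw [hsucc, has]⟩, hv0,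
    hsucc⟩

lemma LongCycle.hasUniqueArrows_of_perm (hN : ∀ i, IsIndecomposable R (N i)) {s : Equiv.Perm ι}
    (hs : ∀ j i, i ≠ s j → numArrows R N j i = 0) {c : LongCycle R N a}
    (hc : ∀ p : Fin c.k, c.v p.succ = s (c.v p.castSucc)) : c.HasUniqueArrows := by
  intro p j hj f hf
  by_contra hf0
  refine (numArrows_ne_zero_iff hN).2 ⟨f, hf, hf0⟩ (hs j _ ?_)
  rw [hc]
  exact s.injective.ne hj.symm

end Permutation

/-! ### The trichotomy -/

section Trichotomy

variable {R : Type u} [Ring R] {ι : Type} {N : ι → Type v} [∀ i, AddCommGroup (N i)]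
  [∀ i, Module R (N i)] [∀ i, Finite (N i)] {a : ι → ℕ}

lemma isUnionOfLoops_or_exists_longCycle [Finite ι] (hN : ∀ i, IsIndecomposable R (N i))
    {s : Equiv.Perm ι} (hs : ∀ j, numArrows R N j (s j) = 1)
    (hs' : ∀ j i, i ≠ s j → numArrows R N j i = 0) (has : ∀ j, a (s j) = a j)
    (htwo : (∃ j i, j ≠ i ∧ numArrows R N j i ≠ 0) →
      ∃ j i, j ≠ i ∧ numArrows R N j i ≠ 0 ∧ ¬ (a j = 1 ∧ Nat.card (Residue R N j) = 2)) :
    IsUnionOfLoops R N ∨ ∃ c : LongCycle R N a, c.HasUniqueArrows ∧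
      ¬ (a (c.v 0) = 1 ∧ Nat.card (Residue R N (c.v 0)) = 2) := by
  refine or_iff_not_imp_right.2 fun hcycle => ?_
  have hfix : ∀ j i, j ≠ i → numArrows R N j i = 0 := by
    by_contra! hne
    obtain ⟨j, i, hji, harrow, hj⟩ := htwo hne
    have hi : i = s j := not_imp_comm.1 (hs' j i) harrow
    obtain ⟨c, rfl, hc⟩ := exists_longCycle_of_perm hN s hs has (hi ▸ hji.symm)
    exact hcycle ⟨c, c.hasUniqueArrows_of_perm hN hs' hc, hj⟩
  refine ⟨fun i => ?_, hfix⟩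
  have hi : s i = i :=
    by_contra fun hsi => one_ne_zero ((hs i).symm.trans (hfix i _ (Ne.symm hsi)))
  simpa only [hi] using hs i

variable {K : Type*} [Field K] [IsAlgClosed K] [CharZero K]
  {χ : AddChar (Module.End R (BigModule N a)) K}

lemma autSplits_of_hom_out_eq_zero [Finite ι]
    (hχ : IsGeneratingChar (Module.End R (BigModule N a)) χ)
    (hN : ∀ i, IsIndecomposable R (N i)) (hne : ∀ i j, i ≠ j → IsEmpty (N i ≃ₗ[R] N j))
    (ha : ∀ i, 0 < a i) {i j : ι} (hij : i ≠ j)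
    (hout : ∀ k (g : N i →ₗ[R] N k), ¬ Function.Bijective g → g = 0) :
    AutSplits R (BigModule N a) :=
  autSplits_of_hom_eq_zero hN ha hij
    (fun k hk g => hout k g fun hg => (hne i k hk.symm).false (LinearEquiv.ofBijective g hg))
    fun _ hk f => eq_zero_of_hom_out_eq_zero hχ hN hne ha hk hout f

lemma exists_perm_numArrows_eq [Finite ι]
    (hχ : IsGeneratingChar (Module.End R (BigModule N a)) χ)
    (hN : ∀ i, IsIndecomposable R (N i)) (hne : ∀ i j, i ≠ j → IsEmpty (N i ≃ₗ[R] N j))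
    (ha : ∀ i, 0 < a i) (hout : ∀ i, ∃ k, ∃ g : N i →ₗ[R] N k, ¬ Function.Bijective g ∧ g ≠ 0) :
    ∃ s : Equiv.Perm ι, (∀ j, numArrows R N j (s j) = 1) ∧
      (∀ j i, i ≠ s j → numArrows R N j i = 0) ∧ ∀ j, a (s j) = a j := by
  classical
  have := Fintype.ofFinite ι
  obtain ⟨s, hs, has⟩ := exists_perm_of_sum_le (numArrows R N) a ha
    (fun i => sum_numArrows_mul_le hχ hN hne (ha i)) fun j => by
      obtain ⟨k, g, hg, hg0⟩ := hout j
      exact exists_numArrows_ne_zero hN hg0 hg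
  exact ⟨s, fun j => by rw [hs, if_pos rfl], fun j i hi => by rw [hs, if_neg hi], has⟩

end Trichotomy

end

end FunctorMorphing

open FunctorMorphing in
theorem theoremD_general {A : Type w} [CommRing A] {R : Type u} [Ring R] [Algebra A R]
    {ι : Type} [Finite ι] [DecidableEq ι] {N : ι → Type v} [∀ i, AddCommGroup (N i)]
    [∀ i, Module R (N i)] [∀ i, Finite (N i)] (hN : ∀ i, IsIndecomposable R (N i))
    (hne : ∀ i j, i ≠ j → IsEmpty (N i ≃ₗ[R] N j)) {a : ι → ℕ} (ha : ∀ i, 0 < a i)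
    {K : Type*} [Field K] [IsAlgClosed K] [CharZero K] {V : Type*} [AddCommGroup V] [Module K V]
    {ρ : Representation K (BigModule N a ≃ₗ[R] BigModule N a) V} (hirr : ρ.IsIrreducible)
    (hρ : ∀ F : FunCat A R N, IsProperSubquotient F (homFunctor A R N a) →
      ∀ T : (permRep K a F).IntertwiningMap ρ, T = 0)
    (hfield : ∀ i, (∀ j, i = j) → ∃ φ : Module.End R (N i), φ ≠ 0 ∧ ¬ Function.Bijective φ)
    (htwo : (∃ j i, j ≠ i ∧ numArrows R N j i ≠ 0) →
      ∃ j i, j ≠ i ∧ numArrows R N j i ≠ 0 ∧ ¬ (a j = 1 ∧ Nat.card (Residue R N j) = 2)) :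
    AutSplits R (BigModule N a) ∨
    (∃ (c : LongCycle R N a) (H : Subgroup (BigModule N a ≃ₗ[R] BigModule N a)),
      H ≠ ⊤ ∧ Nonempty (H ≃* (c.MTilde ≃ₗ[RTilde R] c.MTilde)) ∧ IsInducedFrom ρ H) ∨
    IsUnionOfLoops R N := by
  have hprim := isPrimitiveRep_of_forall_properSubquotient A hρ
  have := nontrivial_of_isIrreducible hirr
  obtain ⟨χ, hχ⟩ := hprim.exists_isGeneratingChar
  by_cases hout : ∀ i, ∃ k, ∃ g : N i →ₗ[R] N k, ¬ Function.Bijective g ∧ g ≠ 0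
  · right
    obtain ⟨s, hs, hs', has⟩ := exists_perm_numArrows_eq hχ hN hne ha hout
    rcases isUnionOfLoops_or_exists_longCycle hN hs hs' has htwo with hloops | ⟨c, hc, hc₀⟩
    · exact Or.inr hloops
    · exact Or.inl ⟨c, autCentralizer c.shift,
        c.autCentralizer_shift_ne_top (hN _) (ha _) hc₀,
        ⟨autCentralizerEquiv c.shift c.shift_comp_shift⟩,
        c.isInducedFrom_autCentralizer hirr hprim hN hne hc⟩
  · left
    push Not at hout
    obtain ⟨i, hi⟩ := hout
    obtain ⟨j, hij⟩ : ∃ j, i ≠ j := by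
      by_contra! hi'
      obtain ⟨φ, hφ0, hφ⟩ := hfield i hi'
      exact hφ0 (hi i φ hφ)
    exact autSplits_of_hom_out_eq_zero hχ hN hne ha hij hi

open FunctorMorphing in
theorem theoremD {𝒪 : Type*} [CommRing 𝒪] [IsDomain 𝒪] [IsDiscreteValuationRing 𝒪]
    [IsAdicComplete (IsLocalRing.maximalIdeal 𝒪) 𝒪] [Finite (IsLocalRing.ResidueField 𝒪)] (ℓ : ℕ)
    {R : Type*} [Ring R] [Finite R] [Algebra (𝒪 ⧸ IsLocalRing.maximalIdeal 𝒪 ^ ℓ) R]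
    {n : ℕ} (N : Fin n → Type*) [∀ i, AddCommGroup (N i)] [∀ i, Module R (N i)]
    [∀ i, Finite (N i)] (hindec : ∀ i, IsIndecomposable R (N i))
    (hnoniso : ∀ i j, i ≠ j → IsEmpty (N i ≃ₗ[R] N j))
    (a : Fin n → ℕ) (ha : ∀ i, 0 < a i)
    {K : Type*} [Field K] [IsAlgClosed K] [CharZero K]
    {V : Type*} [AddCommGroup V] [Module K V]
    (ρ : Representation K (BigModule N a ≃ₗ[R] BigModule N a) V) (hirr : ρ.IsIrreducible)
    (htriv : HasTrivialMorphing (𝒪 ⧸ IsLocalRing.maximalIdeal 𝒪 ^ ℓ) ρ)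
    -- `M` is not a power of a single indecomposable module whose endomorphism ring is a field
    (hfield : n = 1 → ∀ i, ∃ φ : Module.End R (N i), φ ≠ 0 ∧ ¬ Function.Bijective φ)
    -- if some arrow joins distinct vertices, then one of these has source `j` with `GL_{a_j}(E_j) ≠ 1`
    (htwo : (∃ j i, j ≠ i ∧ numArrows R N j i ≠ 0) →
      ∃ j i, j ≠ i ∧ numArrows R N j i ≠ 0 ∧ ¬ (a j = 1 ∧ Nat.card (Residue R N j) = 2)) :
    AutSplits R (BigModule N a) ∨
    (∃ (c : LongCycle R N a) (H : Subgroup (BigModule N a ≃ₗ[R] BigModule N a)),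
      H ≠ ⊤ ∧ Nonempty (H ≃* (c.MTilde ≃ₗ[RTilde R] c.MTilde)) ∧ IsInducedFrom ρ H) ∨
    IsUnionOfLoops R N := by
  obtain ⟨_, _, ⟨⟨_, hρ⟩, _⟩⟩ := htriv
  refine theoremD_general hindec hnoniso ha hirr hρ (fun i hi => hfield ?_ i) htwo
  simpa using Fintype.card_eq_one_iff.2 ⟨i, fun j => (hi j).symm⟩
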